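/- Let $n\in\mathbb N$, let $\Theta$ be a real skew-symmetric $n\times n$ matrix and $m=\lfloor n/2\rfloor$. Let $\mathcal A=C^\infty(\mathbb T^n_\Theta)$ be the smooth noncommutative torus, i.e. the algebra of the series $a=\sum_{k\in\mathbb Z^n}a_kU_k$ with Schwartz coefficients $(a_k)$ and unitaries $U_k$ satisfying $U_kU_q=e^{-\frac i2k\cdot\Theta q}U_{k+q}$, $U_k^*=U_{-k}$. Put $\tau(\sum_ka_kU_k)=a_0$, let $\mathcal H_\tau$ be the GNS Hilbert space of $\tau$ (with orthonormal basis $(U_k)$), let $L$ be the left regular representation, and let $\mathcal A$ act on $\mathcal H=\mathcal H_\tau\otimes\mathbb C^{2^m}$ by $a\mapsto L(a)\otimes 1$. Let $\gamma^1,\dots,\gamma^n$ be hermitian $2^m\times2^m$ matrices with $\gamma^\mu\gamma^\nu+\gamma^\nu\gamma^\mu=2\delta^{\mu\nu}$, let $\mathcal D$ be the selfadjoint Dirac operator on $\mathcal H$ with $\mathcal D(U_k\otimes v)=\sum_\mu k_\mu\,U_k\otimes\gamma^\mu v$, let $\epsilon\in\{1,-1\}$, and let $J=J_0\otimes C_0$,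 where $J_0(a)=a^*$ and $C_0$ is an antiunitary operator on $\mathbb C^{2^m}$ with $C_0^2=\pm1$ and $C_0\gamma^\mu=-\epsilon\gamma^\mu C_0$ for all $\mu$. Let $P_0$ be the orthogonal projection onto $\operatorname{Ker}\mathcal D$ and $D=\mathcal D+P_0$, which is invertible. For a bounded operator $T$ on $\mathcal H$, the noncommutative integral is $$⨍ T:=\operatorname{Res}_{s=0}\operatorname{Tr}\big(T|D|^{-s}\big),$$ where $\operatorname{Tr}(T|D|^{-s})$, defined for $\operatorname{Re}s$ large (where $T|D|^{-s}$ is trace class), is continued meromorphically to $\mathbb C$; the existence of this continuation is part of each of the assertions below. (i) Let $A_1,\dots,A_n\in\mathcal A$ be such that the one-form $A=\sum_\alpha L(-iA_\alpha)\otimes\gamma^\alpha$ is selfadjoint. Then, for all integers $p\ge0$ and $1\le q<n$, $$⨍ A^pD^{-q}=⨍(\epsilon JAJ^{-1})^pD^{-q}=0 .$$ In particular (case $p=q=1$), if $n>1$ then the vanishing tadpole condition $⨍ AD^{-1}=0$ holds; it holds for every one-form $A\in\Omega^1_{\mathcal D}(\mathcal A)=\{\sum_ia_i[\mathcal D,b_i]: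 a_i,b_i\in\mathcal A\}$. (ii) Suppose that $\frac1{2\pi}\Theta$ is Diophantine: there are $c,\delta>0$ such that $\big|\tfrac1{2\pi}\Theta q-m\big|\ge c\,|q|^{-\delta}$ for all $q\in\mathbb Z^n\setminus\{0\}$ and all $m\in\mathbb Z^n$ (Euclidean norms). Then $⨍ BD^{-q}=0$ for every integer $1\le q<n$ and every $B$ in the algebra generated by $\mathcal A$, $[\mathcal D,\mathcal A]$, $J\mathcal AJ^{-1}$ and $J[\mathcal D,\mathcal A]J^{-1}$. -/

import Mathlib

open scoped ComplexConjugate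

noncomputable section

namespace NCTorus

/-! ## Modes, Schwartz sequences, the Diophantine condition -/

/-- Frequencies `k ∈ ℤⁿ`. -/
abbrev Mode (n : ℕ) : Type := Fin n → ℤ

/-- The Euclidean norm of `k ∈ ℤⁿ`. -/
def modeNorm {n : ℕ} (k : Mode n) : ℝ := Real.sqrt (∑ i, (k i : ℝ) ^ 2)

theorem modeNorm_sq {n : ℕ} (k : Mode n) : modeNorm k ^ 2 = ∑ i, (k i : ℝ) ^ 2 :=
  Real.sq_sqrt (Finset.sum_nonneg fun _ _ => sq_nonneg _)

/-- Schwartz sequences on `ℤⁿ`: all the sequences `(1 + |k|²)^r |a_k|²` are bounded. -/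
def IsSchwartz {n : ℕ} (a : Mode n → ℂ) : Prop :=
  ∀ r : ℕ, ∃ C : ℝ, ∀ k, (1 + modeNorm k ^ 2) ^ r * ‖a k‖ ^ 2 ≤ C

/-- A real `n × n` matrix `M` is Diophantine if, for some `c, δ > 0`, the Euclidean distance of
`M q` to every `m ∈ ℤⁿ` is at least `c |q|^(-δ)`, for all nonzero `q ∈ ℤⁿ`. -/
def IsDiophantine {n : ℕ} (M : Matrix (Fin n) (Fin n) ℝ) : Prop :=
  ∃ δ : ℝ, 0 < δ ∧ ∃ c : ℝ, 0 < c ∧ ∀ q : Mode n, q ≠ 0 → ∀ m : Mode n,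
    c * modeNorm q ^ (-δ) ≤ Real.sqrt (∑ i, (M.mulVec (fun j => (q j : ℝ)) i - (m i : ℝ)) ^ 2)

/-- If the vector `a = ᵗM u` satisfies the scalar condition `|q . a - m| ≥ c |q|^(-δ)` for some
`u ∈ ℤⁿ`, then `M` is Diophantine. For a skew-symmetric `M` no such `u` exists, since `u . ᵗM u = 0`;
hence the condition on the distance to `ℤⁿ` above. -/
theorem isDiophantine_of_vector {n : ℕ} (M : Matrix (Fin n) (Fin n) ℝ) (u : Mode n)
    (h : ∃ δ : ℝ, 0 < δ ∧ ∃ c : ℝ, 0 < c ∧ ∀ q : Mode n, q ≠ 0 → ∀ m : ℤ,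
      c * modeNorm q ^ (-δ) ≤ |∑ i, (q i : ℝ) * M.transpose.mulVec (fun j => (u j : ℝ)) i - m|) :
    IsDiophantine M := by
  obtain ⟨δ, hδ, c, hc, h⟩ := h
  have hu : 0 ≤ modeNorm u := Real.sqrt_nonneg _
  refine ⟨δ, hδ, c / (modeNorm u + 1), by positivity, fun q hq m => ?_⟩
  have h1 := h q hq (∑ i, m i * u i)
  set w : Fin n → ℝ := fun i => M.mulVec (fun j => (q j : ℝ)) i - (m i : ℝ) with hw
  have e : (∑ i, (q i : ℝ) * M.transpose.mulVec (fun j => (u j : ℝ)) i - (∑ i, m i * u i : ℤ) : ℝ)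
      = ∑ i, w i * (u i : ℝ) := by
    have e1 : ∑ i, (q i : ℝ) * M.transpose.mulVec (fun j => (u j : ℝ)) i =
        ∑ i, M.mulVec (fun j => (q j : ℝ)) i * (u i : ℝ) := by
      simp only [Matrix.mulVec, dotProduct, Matrix.transpose_apply, Finset.mul_sum, Finset.sum_mul]
      rw [Finset.sum_comm]
      exact Finset.sum_congr rfl fun i _ => Finset.sum_congr rfl fun j _ => by ring
    rw [e1]
    push_cast
    rw [← Finset.sum_sub_distrib]
    exact Finset.sum_congr rfl fun i _ => by rw [hw]; ring
  rw [e] at h1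
  have h2 : |∑ i, w i * (u i : ℝ)| ≤ Real.sqrt (∑ i, w i ^ 2) * modeNorm u := by
    rw [modeNorm, ← Real.sqrt_mul (Finset.sum_nonneg fun _ _ => sq_nonneg _)]
    exact Real.abs_le_sqrt (Finset.sum_mul_sq_le_sq_mul_sq _ _ _)
  have h3 : 0 ≤ Real.sqrt (∑ i, w i ^ 2) := Real.sqrt_nonneg _
  rw [div_mul_eq_mul_div, div_le_iff₀ (by positivity)]
  nlinarith

/-- The pairing `k . Θ q`. -/
def pairing {n : ℕ} (Θ : Matrix (Fin n) (Fin n) ℝ) (k q : Mode n) : ℝ :=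
  ∑ i, ∑ j, (k i : ℝ) * Θ i j * (q j : ℝ)

/-! ## Spinors and Dirac matrices -/

/-- The space of spinors `ℂ^(2^m)`, `m = ⌊n / 2⌋`. -/
def Spinor (n : ℕ) : Type := EuclideanSpace ℂ (Fin (2 ^ (n / 2)))

instance (n : ℕ) : NormedAddCommGroup (Spinor n) :=
  inferInstanceAs (NormedAddCommGroup (EuclideanSpace ℂ (Fin (2 ^ (n / 2)))))

instance (n : ℕ) : InnerProductSpace ℂ (Spinor n) :=
  inferInstanceAs (InnerProductSpace ℂ (EuclideanSpace ℂ (Fin (2 ^ (n / 2)))))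

instance (n : ℕ) : FiniteDimensional ℂ (Spinor n) :=
  inferInstanceAs (FiniteDimensional ℂ (EuclideanSpace ℂ (Fin (2 ^ (n / 2)))))

instance (n : ℕ) : CompleteSpace (Spinor n) :=
  inferInstanceAs (CompleteSpace (EuclideanSpace ℂ (Fin (2 ^ (n / 2)))))

/-- The canonical orthonormal basis `(e_j)` of the spinors. -/
def spinorBasis (n : ℕ) : OrthonormalBasis (Fin (2 ^ (n / 2))) ℂ (Spinor n) :=
  EuclideanSpace.basisFun (Fin (2 ^ (n / 2))) ℂ

/-- Hermitian Dirac matrices on `ℂ^(2^m)`, and an antiunitary charge conjugation `C₀` with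
`C₀ γ^μ = -ε γ^μ C₀` and `C₀² = ± 1`. -/
structure SpinStructure (n : ℕ) where
  gamma : Fin n → (Spinor n →L[ℂ] Spinor n)
  gamma_selfAdjoint : ∀ μ, IsSelfAdjoint (gamma μ)
  clifford : ∀ μ ν, gamma μ * gamma ν + gamma ν * gamma μ = if μ = ν then 2 else 0
  eps : ℂ
  eps_eq : eps = 1 ∨ eps = -1
  C0 : Spinor n ≃ₛₗᵢ[starRingEnd ℂ] Spinor n
  C0_gamma : ∀ μ v, C0 (gamma μ v) = -(eps • gamma μ (C0 v))
  C0_sq : (∀ v, C0 (C0 v) = v) ∨ (∀ v, C0 (C0 v) = -v)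

/-! ## The Hilbert space and the operators acting on it -/

/-- The Hilbert space `H_τ ⊗ ℂ^(2^m)`. The GNS space `H_τ` has the orthonormal basis `(U_k)`, so
that a vector `∑ₖ U_k ⊗ ψ(k)` is the square summable family `ψ` of spinors. -/
abbrev Hil (n : ℕ) : Type := lp (fun _ : Mode n => Spinor n) 2

theorem memℓp_block {n : ℕ} {ρ : ℂ →+* ℂ} (σ : Mode n ≃ Mode n)
    (T : Mode n → Spinor n →SL[ρ] Spinor n) (C : ℝ) (hT : ∀ k v, ‖T k v‖ ≤ C * ‖v‖) (ψ : Hil n) :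
    Memℓp (fun k => T k (ψ (σ k))) 2 := by
  have h2 : (0 : ℝ) < (2 : ENNReal).toReal := by norm_num
  have h1 : Summable fun k => ‖ψ (σ k)‖ ^ (2 : ENNReal).toReal :=
    ((lp.memℓp ψ).summable h2).comp_injective σ.injective
  refine memℓp_gen (Summable.of_nonneg_of_le (fun k => by positivity) (fun k => ?_)
    (h1.mul_left (|C| ^ (2 : ENNReal).toReal)))
  rw [← Real.mul_rpow (abs_nonneg _) (norm_nonneg _)]
  refine Real.rpow_le_rpow (norm_nonneg _) ((hT k _).trans ?_) h2.le
  exact mul_le_mul_of_nonneg_right (le_abs_self C) (norm_nonneg _)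

/-- The bounded operator `ψ ↦ (k ↦ T_k ψ(σ k))` for a permutation `σ` of the modes and a
uniformly bounded family `T` of (linear or antilinear) maps of spinors. -/
def blockOp {n : ℕ} {ρ : ℂ →+* ℂ} (σ : Mode n ≃ Mode n)
    (T : Mode n → Spinor n →SL[ρ] Spinor n) (C : ℝ) (hT : ∀ k v, ‖T k v‖ ≤ C * ‖v‖) :
    Hil n →SL[ρ] Hil n :=
  LinearMap.mkContinuous
    { toFun := fun ψ => ⟨fun k => T k (ψ (σ k)), memℓp_block σ T C hT ψ⟩
      map_add' := fun ψ φ => by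
        ext1; funext k
        simp only [lp.coeFn_add, Pi.add_apply, map_add]
      map_smul' := fun c ψ => by
        ext1; funext k
        simp } |C| (fun ψ => by
    have h2 : (0 : ℝ) < (2 : ENNReal).toReal := by norm_num
    refine lp.norm_le_of_tsum_le h2 (by positivity) ?_
    have h1 := lp.hasSum_norm h2 ψ
    have h1c : HasSum (fun k => ‖ψ (σ k)‖ ^ (2 : ENNReal).toReal) (‖ψ‖ ^ (2 : ENNReal).toReal) :=
      (Equiv.hasSum_iff σ).mpr h1
    rw [Real.mul_rpow (abs_nonneg _) (norm_nonneg _)]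
    refine ((memℓp_block σ T C hT ψ).summable h2).tsum_le_of_sum_le (fun s => ?_) |>.trans le_rfl
    refine (Finset.sum_le_sum (fun k _ => ?_)).trans
      (((h1c.mul_left (|C| ^ (2 : ENNReal).toReal)).summable.sum_le_tsum s
        (fun k _ => by positivity)).trans (h1c.mul_left _).tsum_eq.le)
    rw [← Real.mul_rpow (abs_nonneg _) (norm_nonneg _)]
    refine Real.rpow_le_rpow (norm_nonneg _) ((hT k _).trans ?_) h2.le
    exact mul_le_mul_of_nonneg_right (le_abs_self C) (norm_nonneg _))

@[simp] theorem blockOp_apply {n : ℕ} {ρ : ℂ →+* ℂ} (σ : Mode n ≃ Mode n)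
    (T : Mode n → Spinor n →SL[ρ] Spinor n) (C : ℝ) (hT : ∀ k v, ‖T k v‖ ≤ C * ‖v‖)
    (ψ : Hil n) (k : Mode n) : blockOp σ T C hT ψ k = T k (ψ (σ k)) := rfl

theorem norm_blockOp_le {n : ℕ} (σ : Mode n ≃ Mode n)
    (T : Mode n → Spinor n →L[ℂ] Spinor n) (C : ℝ) (hT : ∀ k v, ‖T k v‖ ≤ C * ‖v‖) :
    ‖blockOp σ T C hT‖ ≤ |C| := by
  unfold blockOp
  exact LinearMap.mkContinuous_norm_le _ (abs_nonneg _) _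

/-- The operator `L(U_l) ⊗ M`: since `U_l U_r = e^(-(i/2) l.Θr) U_(l+r)`, it sends `U_r ⊗ v` to
`e^(-(i/2) l.Θr) U_(l+r) ⊗ M v`. -/
def weyl {n : ℕ} (Θ : Matrix (Fin n) (Fin n) ℝ) (l : Mode n) (M : Spinor n →L[ℂ] Spinor n) :
    Hil n →L[ℂ] Hil n :=
  blockOp (Equiv.subRight l)
    (fun k => Complex.exp (-(Complex.I / 2) * (pairing Θ l (k - l) : ℂ)) • M) ‖M‖ (fun k v => by
      have : ‖Complex.exp (-(Complex.I / 2) * (pairing Θ l (k - l) : ℂ))‖ = 1 := by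
        rw [Complex.norm_exp]; simp
      rw [smul_apply, norm_smul, this, one_mul]
      exact M.le_opNorm v)

/-- The Weyl relations `U_k U_q = e^(-(i/2) k.Θq) U_(k+q)`. -/
theorem weyl_mul_weyl {n : ℕ} (Θ : Matrix (Fin n) (Fin n) ℝ) (k q : Mode n)
    (M N : Spinor n →L[ℂ] Spinor n) :
    weyl Θ k M * weyl Θ q N =
      Complex.exp (-(Complex.I / 2) * (pairing Θ k q : ℂ)) • weyl Θ (k + q) (M * N) := by
  have hp : ∀ r, pairing Θ k (r - k) + pairing Θ q (r - k - q) =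
      pairing Θ k q + pairing Θ (k + q) (r - (k + q)) := fun r => by
    simp only [pairing, ← Finset.sum_add_distrib]
    refine Finset.sum_congr rfl fun i _ => Finset.sum_congr rfl fun j _ => ?_
    simp only [Pi.sub_apply, Pi.add_apply, Int.cast_sub, Int.cast_add]
    ring
  ext ψ : 1
  ext1; funext r
  simp only [weyl, mul_apply_eq_comp, smul_apply, lp.coeFn_smul, Pi.smul_apply,
    blockOp_apply, Equiv.subRight_apply, map_smul, smul_smul, ← Complex.exp_add, ← mul_add,
    ← Complex.ofReal_add]
  rw [add_comm (pairing Θ q _), hp r, sub_sub]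

/-- The operator `L(a) ⊗ M = ∑ₗ a_l L(U_l) ⊗ M`, where `a = ∑ₗ a_l U_l` is an element of the smooth
noncommutative torus. For a Schwartz sequence the series converges absolutely in operator norm. -/
def leftMul {n : ℕ} (Θ : Matrix (Fin n) (Fin n) ℝ) (a : Mode n → ℂ)
    (M : Spinor n →L[ℂ] Spinor n) : Hil n →L[ℂ] Hil n :=
  ∑' l, a l • weyl Θ l M

theorem norm_weyl_le {n : ℕ} (Θ : Matrix (Fin n) (Fin n) ℝ) (l : Mode n)
    (M : Spinor n →L[ℂ] Spinor n) : ‖weyl Θ l M‖ ≤ ‖M‖ :=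
  (norm_blockOp_le _ _ _ _).trans (abs_norm M).le

theorem IsSchwartz.summable_norm {n : ℕ} {a : Mode n → ℂ} (ha : IsSchwartz a) :
    Summable fun l => ‖a l‖ := by
  obtain ⟨C, hC⟩ := ha (2 * n)
  have hs1 : Summable fun m : ℤ => (1 + (m : ℝ) ^ 2)⁻¹ := by
    have h0 : Summable fun m : ℤ => 1 / (m : ℝ) ^ 2 :=
      Real.summable_one_div_int_pow.mpr (by norm_num)
    refine Summable.of_norm_bounded_eventually h0 ?_
    rw [Filter.eventually_cofinite]
    refine (Set.finite_singleton (0 : ℤ)).subset fun m hm => ?_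
    by_contra hne
    have hne0 : (m : ℝ) ≠ 0 := by exact_mod_cast hne
    have hm2 : (0 : ℝ) < (m : ℝ) ^ 2 := by positivity
    refine hm ?_
    rw [Real.norm_of_nonneg (by positivity), one_div]
    exact inv_anti₀ hm2 (by linarith)
  have hs : Summable fun l : Mode n => ∏ i, (1 + (l i : ℝ) ^ 2)⁻¹ := by
    refine summable_of_sum_le (c := ∏ _i : Fin n, ∑' m : ℤ, (1 + (m : ℝ) ^ 2)⁻¹)
      (fun l => Finset.prod_nonneg fun i _ => by positivity) fun u => ?_
    classical
    have hu : u ⊆ Fintype.piFinset fun i => u.image fun l => l i := fun l hl => by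
      rw [Fintype.mem_piFinset]
      exact fun i => Finset.mem_image_of_mem _ hl
    refine (Finset.sum_le_sum_of_subset_of_nonneg hu
      fun l _ _ => Finset.prod_nonneg fun i _ => by positivity).trans ?_
    rw [← Finset.prod_univ_sum (fun i => u.image fun l => l i)
      (fun (_ : Fin n) (m : ℤ) => (1 + (m : ℝ) ^ 2)⁻¹)]
    exact Finset.prod_le_prod (fun i _ => Finset.sum_nonneg fun m _ => by positivity)
      fun i _ => hs1.sum_le_tsum _ fun m _ => by positivity
  refine Summable.of_nonneg_of_le (fun _ => norm_nonneg _) (fun l => ?_) (hs.mul_left (Real.sqrt C))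
  have hpos : 0 < ∏ i, (1 + (l i : ℝ) ^ 2) := Finset.prod_pos fun i _ => by positivity
  have hle : ∏ i, (1 + (l i : ℝ) ^ 2) ≤ (1 + modeNorm l ^ 2) ^ n := by
    have := Finset.prod_le_prod (s := Finset.univ) (f := fun i => 1 + (l i : ℝ) ^ 2)
      (g := fun _ : Fin n => 1 + modeNorm l ^ 2) (fun i _ => by positivity) fun i _ => by
        rw [modeNorm_sq]
        have := Finset.single_le_sum (f := fun i => (l i : ℝ) ^ 2)
          (fun _ _ => sq_nonneg _) (Finset.mem_univ i)
        simpa using this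
    simpa using this
  rw [Finset.prod_inv_distrib, ← div_eq_mul_inv, le_div_iff₀ hpos]
  refine Real.le_sqrt_of_sq_le (le_trans ?_ (hC l))
  rw [mul_pow, mul_comm, pow_mul', ]
  gcongr

/-- The series that defines `L(a) ⊗ M` converges absolutely. -/
theorem IsSchwartz.summable_leftMul {n : ℕ} (Θ : Matrix (Fin n) (Fin n) ℝ) {a : Mode n → ℂ}
    (ha : IsSchwartz a) (M : Spinor n →L[ℂ] Spinor n) :
    Summable fun l => ‖a l • weyl Θ l M‖ :=
  Summable.of_nonneg_of_le (fun _ => norm_nonneg _)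
    (fun l => (norm_smul_le _ _).trans
      (mul_le_mul_of_nonneg_left (norm_weyl_le Θ l M) (norm_nonneg _)))
    (ha.summable_norm.mul_right ‖M‖)

/-- The algebra `𝒜` of the smooth noncommutative torus, represented on the Hilbert space as
`L(a) ⊗ 1`. -/
def torusAlg (n : ℕ) (Θ : Matrix (Fin n) (Fin n) ℝ) : Set (Hil n →L[ℂ] Hil n) :=
  {T | ∃ a : Mode n → ℂ, IsSchwartz a ∧ T = leftMul Θ a 1}

/-- Clifford multiplication `k_μ γ^μ`. -/
def slash {n : ℕ} (S : SpinStructure n) (k : Mode n) : Spinor n →L[ℂ] Spinor n :=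
  ∑ μ, (k μ : ℂ) • S.gamma μ

/-- The selfadjoint Dirac operator `𝒟 = -i δ_μ ⊗ γ^μ`, that is `𝒟 (U_k ⊗ v) = U_k ⊗ k_μ γ^μ v`, on
its maximal domain. -/
def dirac {n : ℕ} (S : SpinStructure n) : Hil n →ₗ.[ℂ] Hil n where
  domain :=
    { carrier := {ψ | Memℓp (fun k => slash S k (ψ k)) 2}
      add_mem' := fun {ψ φ} hψ hφ => by
        have := Memℓp.add hψ hφ
        refine (congrArg (fun f => Memℓp f 2) ?_).mp this
        funext k; simp
      zero_mem' := by
        refine (congrArg (fun f => Memℓp f 2) ?_).mp (zero_memℓp (E := fun _ : Mode n => Spinor n))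
        funext k; simp
      smul_mem' := fun c ψ hψ => by
        have := Memℓp.const_smul hψ c
        refine (congrArg (fun f => Memℓp f 2) ?_).mp this
        funext k; simp }
  toFun :=
    { toFun := fun ψ => ⟨fun k => slash S k ((ψ : Hil n) k), ψ.2⟩
      map_add' := fun ψ φ => by
        ext1; funext k
        simp only [Submodule.coe_add, lp.coeFn_add, Pi.add_apply, map_add]
      map_smul' := fun c ψ => by
        ext1; funext k; simp }

/-- `C` is the commutator `[D, T]` of an unbounded operator `D` with a bounded operator `T`: on the
domain of `D`, which `T` preserves, `D T - T D = C`. -/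
def IsCommutator {n : ℕ} (D : Hil n →ₗ.[ℂ] Hil n) (T C : Hil n →L[ℂ] Hil n) : Prop :=
  ∀ ψ : D.domain, ∃ h : T (ψ : Hil n) ∈ D.domain, D ⟨T (ψ : Hil n), h⟩ - T (D ψ) = C (ψ : Hil n)

/-- The set `[𝒟, 𝒜]`. -/
def diracComm {n : ℕ} (Θ : Matrix (Fin n) (Fin n) ℝ) (S : SpinStructure n) :
    Set (Hil n →L[ℂ] Hil n) :=
  {C | ∃ T ∈ torusAlg n Θ, IsCommutator (dirac S) T C}

/-- The space `Ω¹ = {∑ᵢ aᵢ [𝒟, bᵢ]}` of one-forms. -/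
def oneForms {n : ℕ} (Θ : Matrix (Fin n) (Fin n) ℝ) (S : SpinStructure n) :
    Submodule ℂ (Hil n →L[ℂ] Hil n) :=
  Submodule.span ℂ {X | ∃ T ∈ torusAlg n Θ, ∃ C ∈ diracComm Θ S, X = T * C}

/-- The one-form `L(-i A_α) ⊗ γ^α = -i ∑ₗ a_(α,l) U_l ⊗ γ^α`, where `A_α = ∑ₗ a_(α,l) U_l`. -/
def oneForm {n : ℕ} (Θ : Matrix (Fin n) (Fin n) ℝ) (S : SpinStructure n)
    (a : Fin n → Mode n → ℂ) : Hil n →L[ℂ] Hil n :=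
  ∑ α, (-Complex.I) • leftMul Θ (a α) (S.gamma α)

/-- The reality operator `J = J₀ ⊗ C₀`, where `J₀ (∑ₖ c_k U_k) = ∑ₖ conj c_k U_(-k)` is the Tomita
conjugation `J₀(a) = a^*`. -/
def realJ {n : ℕ} (S : SpinStructure n) : Hil n →SL[starRingEnd ℂ] Hil n :=
  blockOp (Equiv.neg _) (fun _ => S.C0.toContinuousLinearEquiv.toContinuousLinearMap) 1
    (fun _ v => by simp)

/-- The inverse of `J`. -/
def realJInv {n : ℕ} (S : SpinStructure n) : Hil n →SL[starRingEnd ℂ] Hil n :=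
  blockOp (Equiv.neg _) (fun _ => S.C0.symm.toContinuousLinearEquiv.toContinuousLinearMap) 1
    (fun _ v => by simp)

theorem realJ_realJInv {n : ℕ} (S : SpinStructure n) (ψ : Hil n) :
    realJ S (realJInv S ψ) = ψ ∧ realJInv S (realJ S ψ) = ψ := by
  constructor <;> (ext1; funext k; simp [realJ, realJInv])

/-- `J T J⁻¹`. -/
def conjJ {n : ℕ} (S : SpinStructure n) (T : Hil n →L[ℂ] Hil n) : Hil n →L[ℂ] Hil n :=
  (realJ S).comp (T.comp (realJInv S))

/-- The algebra generated by `𝒜`, `[𝒟, 𝒜]`, `J 𝒜 J⁻¹` and `J [𝒟, 𝒜] J⁻¹`. -/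
def bigAlg {n : ℕ} (Θ : Matrix (Fin n) (Fin n) ℝ) (S : SpinStructure n) :
    Subalgebra ℂ (Hil n →L[ℂ] Hil n) :=
  Algebra.adjoin ℂ (torusAlg n Θ ∪ diracComm Θ S ∪ conjJ S '' torusAlg n Θ ∪
    conjJ S '' diracComm Θ S)

/-! ## The invertible operator `D = 𝒟 + P₀` and its powers -/

/-- The operator `P₀`, which is the orthogonal projection onto `Ker 𝒟 = U_0 ⊗ ℂ^(2^m)`. -/
def kerProj (n : ℕ) : Hil n →L[ℂ] Hil n :=
  blockOp (Equiv.refl _) (fun k => if k = 0 then 1 else 0) 1 (fun k v => by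
    split_ifs <;> simp)

theorem one_le_modeNorm {n : ℕ} {k : Mode n} (hk : k ≠ 0) : 1 ≤ modeNorm k := by
  obtain ⟨i, hi⟩ := Function.ne_iff.mp hk
  rw [modeNorm, Real.one_le_sqrt]
  have h1 : (1 : ℝ) ≤ (k i : ℝ) ^ 2 := by
    have : (1 : ℤ) ≤ (k i) ^ 2 := by
      have := sq_pos_of_ne_zero (show k i ≠ 0 from hi)
      omega
    exact_mod_cast this
  exact h1.trans (Finset.single_le_sum (f := fun i => (k i : ℝ) ^ 2)
    (fun _ _ => sq_nonneg _) (Finset.mem_univ i))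

theorem abs_le_modeNorm {n : ℕ} (k : Mode n) (i : Fin n) : |(k i : ℝ)| ≤ modeNorm k := by
  rw [← Real.sqrt_sq_eq_abs]
  exact Real.sqrt_le_sqrt (Finset.single_le_sum (f := fun i => (k i : ℝ) ^ 2)
    (fun _ _ => sq_nonneg _) (Finset.mem_univ i))

theorem slash_sq {n : ℕ} (S : SpinStructure n) (k : Mode n) :
    slash S k * slash S k = ((modeNorm k ^ 2 : ℝ) : ℂ) • 1 := by
  have key : (2 : ℂ) • (slash S k * slash S k) = (2 : ℂ) • (((modeNorm k ^ 2 : ℝ) : ℂ) • 1) := by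
    have e1 : slash S k * slash S k =
        ∑ μ, ∑ ν, ((k μ : ℂ) * (k ν : ℂ)) • (S.gamma μ * S.gamma ν) := by
      simp only [slash, Finset.sum_mul, Finset.mul_sum, smul_mul_smul_comm]
      exact Finset.sum_comm
    have e2 : slash S k * slash S k =
        ∑ μ, ∑ ν, ((k μ : ℂ) * (k ν : ℂ)) • (S.gamma ν * S.gamma μ) := by
      rw [e1, Finset.sum_comm]
      simp only [mul_comm]
    rw [two_smul]
    nth_rewrite 1 [e1]
    rw [e2]
    simp only [← Finset.sum_add_distrib, ← smul_add, S.clifford]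
    rw [modeNorm_sq]
    simp only [smul_ite, smul_zero, Finset.sum_ite_eq, Finset.mem_univ, if_true]
    push_cast
    rw [Finset.sum_smul, Finset.smul_sum]
    refine Finset.sum_congr rfl fun μ _ => ?_
    rw [← sq, smul_comm, two_smul, one_add_one_eq_two]
  exact smul_right_injective _ (two_ne_zero) key

/-- The symbol `k_μ γ^μ / |k|²` of `D⁻¹` on `U_k ⊗ ℂ^(2^m)` for `k ≠ 0`; the symbol at `0` is `1`. -/
def diracInvSymbol {n : ℕ} (S : SpinStructure n) (k : Mode n) : Spinor n →L[ℂ] Spinor n :=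
  if k = 0 then 1 else (((modeNorm k ^ 2)⁻¹ : ℝ) : ℂ) • slash S k

theorem diracInvSymbol_bound {n : ℕ} (S : SpinStructure n) (k : Mode n) (v : Spinor n) :
    ‖diracInvSymbol S k v‖ ≤ (1 + ∑ μ, ‖S.gamma μ‖) * ‖v‖ := by
  have h0 : 0 ≤ ∑ μ, ‖S.gamma μ‖ := Finset.sum_nonneg fun _ _ => norm_nonneg _
  unfold diracInvSymbol
  split_ifs with hk
  · simp only [one_apply_eq_self]
    nlinarith [norm_nonneg v]
  · have h1 := one_le_modeNorm hk
    have h2 : ‖slash S k‖ ≤ modeNorm k * ∑ μ, ‖S.gamma μ‖ := by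
      rw [slash, Finset.mul_sum]
      refine norm_sum_le_of_le _ fun μ _ => ?_
      rw [norm_smul]
      refine mul_le_mul_of_nonneg_right ?_ (norm_nonneg _)
      simpa using abs_le_modeNorm k μ
    have h3 : ‖slash S k v‖ ≤ modeNorm k * (∑ μ, ‖S.gamma μ‖) * ‖v‖ :=
      (ContinuousLinearMap.le_opNorm _ v).trans (mul_le_mul_of_nonneg_right h2 (norm_nonneg _))
    rw [smul_apply, norm_smul, Complex.norm_real, Real.norm_eq_abs,
      abs_of_nonneg (by positivity), inv_mul_le_iff₀ (by positivity)]
    refine h3.trans ?_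
    have h4 : modeNorm k ≤ modeNorm k ^ 2 := by nlinarith
    calc modeNorm k * (∑ μ, ‖S.gamma μ‖) * ‖v‖
        = modeNorm k * ((∑ μ, ‖S.gamma μ‖) * ‖v‖) := by ring
      _ ≤ modeNorm k ^ 2 * ((1 + ∑ μ, ‖S.gamma μ‖) * ‖v‖) := by
          refine mul_le_mul h4 ?_ (by positivity) (by positivity)
          nlinarith [norm_nonneg v]

/-- The bounded operator `D⁻¹`, where `D = 𝒟 + P₀`. -/
def diracInv {n : ℕ} (S : SpinStructure n) : Hil n →L[ℂ] Hil n :=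
  blockOp (Equiv.refl _) (diracInvSymbol S) _ (diracInvSymbol_bound S)

theorem slash_zero {n : ℕ} (S : SpinStructure n) : slash S 0 = 0 := by simp [slash]

theorem slash_slash_apply {n : ℕ} (S : SpinStructure n) (k : Mode n) (v : Spinor n) :
    slash S k (slash S k v) = ((modeNorm k ^ 2 : ℝ) : ℂ) • v := by
  have := congrArg (fun T : Spinor n →L[ℂ] Spinor n => T v) (slash_sq S k)
  simpa using this

theorem symbol_left {n : ℕ} (S : SpinStructure n) (k : Mode n) (v : Spinor n) :
    slash S k (diracInvSymbol S k v) + (if k = 0 then diracInvSymbol S k v else 0) = v := by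
  unfold diracInvSymbol
  split_ifs with hk
  · subst hk; simp [slash_zero]
  · have h1 := one_le_modeNorm hk
    have h2 : (((modeNorm k ^ 2)⁻¹ : ℝ) : ℂ) * ((modeNorm k ^ 2 : ℝ) : ℂ) = 1 := by
      rw [← Complex.ofReal_mul, inv_mul_cancel₀ (by positivity), Complex.ofReal_one]
    rw [smul_apply, map_smul, slash_slash_apply, smul_smul, h2, one_smul,
      add_zero]

/-- The kernel of `𝒟` is the range of `P₀`. -/
theorem dirac_eq_zero_iff {n : ℕ} (S : SpinStructure n) (ψ : (dirac S).domain) :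
    dirac S ψ = 0 ↔ kerProj n (ψ : Hil n) = (ψ : Hil n) := by
  constructor
  · intro h
    ext1; funext k
    have hk : slash S k ((ψ : Hil n) k) = 0 := congrArg (fun φ : Hil n => φ k) h
    by_cases h0 : k = 0
    · simp [kerProj, h0]
    · have h1 := one_le_modeNorm h0
      have h2 := slash_slash_apply S k ((ψ : Hil n) k)
      rw [hk, map_zero, eq_comm, smul_eq_zero] at h2
      rcases h2 with h2 | h2
      · have : modeNorm k ^ 2 = 0 := by exact_mod_cast h2
        nlinarith
      · simp [kerProj, h0, h2]
  · intro h
    ext1; funext k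
    change slash S k ((ψ : Hil n) k) = 0
    by_cases h0 : k = 0
    · simp [h0, slash_zero]
    · have := congrArg (fun φ : Hil n => φ k) h
      simp [kerProj, h0] at this
      rw [← this, map_zero]

/-- `diracInv` is the two-sided inverse of `D = 𝒟 + P₀`. -/
theorem diracInv_spec {n : ℕ} (S : SpinStructure n) :
    (∀ ψ : Hil n, ∃ h : diracInv S ψ ∈ (dirac S).domain,
      dirac S ⟨diracInv S ψ, h⟩ + kerProj n (diracInv S ψ) = ψ) ∧
    ∀ ψ : (dirac S).domain, diracInv S (dirac S ψ + kerProj n (ψ : Hil n)) = (ψ : Hil n) := by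
  constructor
  · intro ψ
    have e : (fun k => slash S k (diracInv S ψ k)) = fun k => (ψ - kerProj n (diracInv S ψ)) k := by
      funext k
      have h := symbol_left S k (ψ k)
      rw [lp.coeFn_sub, Pi.sub_apply, eq_sub_iff_add_eq]
      refine Eq.trans ?_ h
      congr 1
      simp only [kerProj, diracInv, blockOp_apply, Equiv.refl_apply]
      split_ifs <;> simp
    have h : diracInv S ψ ∈ (dirac S).domain := by
      change Memℓp (fun k => slash S k (diracInv S ψ k)) 2
      rw [e]
      exact lp.memℓp _
    refine ⟨h, ?_⟩
    ext1; funext k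
    have := congrFun e k
    rw [lp.coeFn_sub, Pi.sub_apply, eq_sub_iff_add_eq] at this
    exact this
  · intro ψ
    ext1; funext k
    change diracInvSymbol S k (slash S k ((ψ : Hil n) k) + kerProj n (ψ : Hil n) k) = _
    by_cases hk : k = 0
    · subst hk; simp [diracInvSymbol, kerProj, slash_zero]
    · have h := symbol_left S k ((ψ : Hil n) k)
      simp [diracInvSymbol, hk] at h
      simp [diracInvSymbol, kerProj, hk, h]

/-- The bounded operator `|D|^(-s)`, for `Re s ≥ 0`: as `D² = |k|²` on `U_k ⊗ ℂ^(2^m)` for `k ≠ 0`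
and `D² = 1` for `k = 0`, it is `|k|^(-s)` for `k ≠ 0` and `1` for `k = 0`. -/
def absDiracPow (n : ℕ) (s : ℂ) (hs : 0 ≤ s.re) : Hil n →L[ℂ] Hil n :=
  blockOp (Equiv.refl _)
    (fun k => (if k = 0 then (1 : ℂ) else (modeNorm k : ℂ) ^ (-s)) • (1 : Spinor n →L[ℂ] Spinor n))
    1 (fun k v => by
      rw [smul_apply, norm_smul, one_apply_eq_self]
      refine mul_le_mul_of_nonneg_right ?_ (norm_nonneg _)
      split_ifs with hk
      · simp
      · have h1 := one_le_modeNorm hk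
        rw [Complex.norm_cpow_eq_rpow_re_of_pos (by linarith)]
        exact Real.rpow_le_one_of_one_le_of_nonpos h1 (by simpa using hs))

theorem absDiracPow_two {n : ℕ} (S : SpinStructure n) (hs : 0 ≤ (2 : ℂ).re) :
    absDiracPow n 2 hs = diracInv S * diracInv S := by
  ext ψ : 1
  ext1; funext k
  simp only [absDiracPow, diracInv, mul_apply_eq_comp, blockOp_apply,
    Equiv.refl_apply, diracInvSymbol, smul_apply, one_apply_eq_self]
  split_ifs with hk
  · simp
  · have h1 : (modeNorm k : ℂ) ≠ 0 := by
      have := one_le_modeNorm hk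
      exact_mod_cast (by linarith : modeNorm k ≠ 0)
    rw [smul_apply, smul_apply, map_smul, slash_slash_apply, smul_smul, smul_smul, Complex.cpow_neg]
    congr 1
    have : (modeNorm k : ℂ) ^ (2 : ℂ) = (modeNorm k : ℂ) ^ (2 : ℕ) := by
      rw [← Complex.cpow_natCast]; norm_num
    rw [this]
    push_cast
    field_simp

theorem absDiracPow_add (n : ℕ) (s t : ℂ) (hs : 0 ≤ s.re) (ht : 0 ≤ t.re)
    (hst : 0 ≤ (s + t).re) :
    absDiracPow n (s + t) hst = absDiracPow n s hs * absDiracPow n t ht := by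
  ext ψ : 1
  ext1; funext k
  simp only [absDiracPow, mul_apply_eq_comp, blockOp_apply, Equiv.refl_apply,
    smul_apply, one_apply_eq_self, smul_smul]
  split_ifs with hk
  · simp
  · have h1 : (modeNorm k : ℂ) ≠ 0 := by
      have := one_le_modeNorm hk
      exact_mod_cast (by linarith : modeNorm k ≠ 0)
    rw [neg_add, Complex.cpow_add _ _ h1]

/-! ## The noncommutative integral -/

/-- The basis vector `U_k ⊗ e_j`. -/
def basisVec {n : ℕ} (p : Mode n × Fin (2 ^ (n / 2))) : Hil n :=
  lp.single 2 p.1 (spinorBasis n p.2)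

/-- Trace class operators, as the operators `∑ᵢ ⟨yᵢ, ·⟩ xᵢ` with `∑ᵢ ‖xᵢ‖ ‖yᵢ‖ < ∞`. -/
def IsTraceClass {n : ℕ} (T : Hil n →L[ℂ] Hil n) : Prop :=
  ∃ (ι : Type) (x y : ι → Hil n), Summable (fun i => ‖x i‖ * ‖y i‖) ∧
    ∀ ψ, HasSum (fun i => (inner ℂ (y i) ψ) • x i) (T ψ)

/-- The trace, `Tr T = ∑ ⟨U_k ⊗ e_j, T (U_k ⊗ e_j)⟩`. -/
def opTrace {n : ℕ} (T : Hil n →L[ℂ] Hil n) : ℂ :=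
  ∑' p : Mode n × Fin (2 ^ (n / 2)), inner ℂ (basisVec p) (T (basisVec p))

/-- `c` is the residue of `f` at `z₀`: the integral `(2πi)⁻¹ ∮ f` over all small circles around
`z₀` is `c`. -/
def HasResidue (f : ℂ → ℂ) (z₀ c : ℂ) : Prop :=
  ∀ᶠ r : ℝ in nhdsWithin 0 (Set.Ioi 0),
    (2 * Real.pi * Complex.I)⁻¹ * (∮ z in C(z₀, r), f z) = c

/-- The noncommutative integral of the bounded operator `T` exists and is `c`: for `Re s` large
enough, `T |D|^(-s)` is trace class, the function `s ↦ Tr (T |D|^(-s))` extends meromorphically to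
the complex plane, and the residue of the extension at `s = 0` is `c`. -/
def HasNCIntegral {n : ℕ} (T : Hil n →L[ℂ] Hil n) (c : ℂ) : Prop :=
  ∃ (F : ℂ → ℂ) (R : ℝ) (hR : 0 ≤ R), Meromorphic F ∧
    (∀ (s : ℂ) (hs : R < s.re),
      IsTraceClass (T * absDiracPow n s (hR.trans hs.le)) ∧
        opTrace (T * absDiracPow n s (hR.trans hs.le)) = F s) ∧
    HasResidue F 0 c

end NCTorus

end

open NCTorus

/-!
Consider the series of twisted translations `U_l · U_m`, `l, m ∈ ℤⁿ`, whose operator-valued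
coefficients decay rapidly. They form an algebra which contains the left multiplications, the
one-forms and their conjugates by `J`. Only the frequencies `(l, -l)` contribute to the diagonal
blocks of such an operator, and there the twisted translation acts by a character of `ℤⁿ`. Hence,
up to a constant from the mode `0`, the trace of `T D^(-q) |D|^(-s)` is a combination, with rapidly
decaying coefficients, of the series `∑ χ(k) k_μ^d |k|^(-s - q - d)` over `k ≠ 0`, where `χ` runs
through these characters and `d` is the parity of `q`.

If `χ(e) ≠ 1` for a unit vector `e`, then `χ` is, to every order, an iterated difference of bounded
functions, and repeated summation by parts makes its series entire. The constants are bounded by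
powers of `|χ(e) - 1|⁻¹`, so the sum over `χ` converges as soon as these small divisors are bounded
below by a power of the frequency. The trivial character gives the lattice zeta series
`∑ k_μ^d |k|^(-z)`. Comparing the sum over `ℤⁿ` with the sum over `2ℤⁿ`, whose indicator is an
average of characters with values `±1`, shows that it becomes entire after multiplication by
`2^(n + d - z) - 1`. Its poles therefore lie on the line `Re z = n + d`, and for `z = s + q + d` and
`q ≠ n` it is holomorphic at `s = 0`.
-/

noncomputable section

namespace NCTorus

variable {n : ℕ}

/-! ### Lattice sums -/

theorem modeNorm_nonneg (k : Mode n) : 0 ≤ modeNorm k := Real.sqrt_nonneg _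

theorem modeNorm_pos {k : Mode n} (hk : k ≠ 0) : 0 < modeNorm k :=
  zero_lt_one.trans_le (one_le_modeNorm hk)

theorem summable_modeNorm_rpow {r : ℝ} (hr : r < -n) :
    Summable fun k : Mode n => modeNorm k ^ r := by
  let b := (EuclideanSpace.basisFun (Fin n) ℝ).toBasis
  let L := Submodule.span ℤ (Set.range b)
  have hL : r < -Module.finrank ℤ L := by simpa [L, ZLattice.rank ℝ] using hr
  let toL := (b.restrictScalars ℤ).equivFun.symm
  have norm_toL (k : Mode n) : ‖toL k‖ = modeNorm k := by
    have toL_apply (i : Fin n) : (toL k : EuclideanSpace ℝ (Fin n)) i = k i := by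
      have : b.repr (toL k) i = k i := by
        rw [← b.restrictScalars_repr_apply ℤ, ← Module.Basis.equivFun_apply]
        exact congrArg Int.cast (congrFun ((b.restrictScalars ℤ).equivFun.apply_symm_apply k) i)
      simpa [b] using this
    simp [modeNorm, EuclideanSpace.norm_eq, toL_apply]
  refine ((ZLattice.summable_norm_rpow L r hL).comp_injective toL.injective).congr fun k => ?_
  rw [Function.comp_apply, norm_toL]

theorem finite_setOf_modeNorm_lt (n : ℕ) (K : ℝ) : {k : Mode n | modeNorm k < K}.Finite := by
  refine (Set.finite_Icc (fun _ => -⌈K⌉ : Mode n) fun _ => ⌈K⌉).subset fun k hk => ?_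
  have abs_le_ceil (i : Fin n) : |k i| ≤ ⌈K⌉ := by
    have : ((|k i| : ℤ) : ℝ) ≤ K := by
      push_cast
      exact (abs_le_modeNorm k i).trans (le_of_lt hk)
    exact_mod_cast this.trans (Int.le_ceil K)
  exact ⟨fun i => (abs_le.mp (abs_le_ceil i)).1, fun i => (abs_le.mp (abs_le_ceil i)).2⟩

/-! ### Differences of holomorphic functions -/

section Cauchy

variable {E : Type*} [NormedAddCommGroup E] [NormedSpace ℂ E] {h : ℂ → E} {x c : ℂ} {R ρ A : ℝ}

theorem add_mem_ball_of_mem_ball_sub {r : ℝ} {z : ℂ} (hz : z ∈ Metric.ball x (r - ‖c‖)) :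
    z + c ∈ Metric.ball x r := by
  rw [mem_ball_iff_norm] at hz ⊢
  calc ‖z + c - x‖ = ‖(z - x) + c‖ := by ring_nf
    _ ≤ ‖z - x‖ + ‖c‖ := norm_add_le _ _
    _ < r := by linarith

theorem differentiableOn_fwdDiff_ball {r : ℝ} (hd : DifferentiableOn ℂ h (Metric.ball x r)) :
    DifferentiableOn ℂ (fwdDiff c h) (Metric.ball x (r - ‖c‖)) :=
  (hd.comp (by fun_prop) fun _ => add_mem_ball_of_mem_ball_sub).sub
    (hd.mono (Metric.ball_subset_ball (by linarith [norm_nonneg c])))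

theorem norm_fwdDiff_le_of_differentiableOn (hρ : 0 < ρ)
    (hd : DifferentiableOn ℂ h (Metric.ball x R)) (hA : ∀ z ∈ Metric.ball x R, ‖h z‖ ≤ A)
    {z : ℂ} (hz : z ∈ Metric.ball x (R - (ρ + ‖c‖))) : ‖fwdDiff c h z‖ ≤ A * (‖c‖ / ρ) := by
  have closedBall_subset {w : ℂ} (hw : w ∈ Metric.ball x (R - ρ)) :
      Metric.closedBall w ρ ⊆ Metric.ball x R :=
    Metric.closedBall_subset_ball' (by rw [Metric.mem_ball] at hw; linarith)
  have norm_deriv_le (w : ℂ) (hw : w ∈ Metric.ball x (R - ρ)) : ‖deriv h w‖ ≤ A / ρ :=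
    Complex.norm_deriv_le_of_forall_mem_sphere_norm_le hρ
      ((hd.mono (closedBall_subset hw)).diffContOnCl_ball subset_rfl)
      fun y hy => hA y (closedBall_subset hw (Metric.sphere_subset_closedBall hy))
  have hz' : z ∈ Metric.ball x (R - ρ - ‖c‖) := by rwa [sub_sub]
  calc ‖fwdDiff c h z‖ ≤ A / ρ * ‖z + c - z‖ :=
        (convex_ball x (R - ρ)).norm_image_sub_le_of_norm_deriv_le
          (fun w hw => hd.differentiableAt
            (Metric.isOpen_ball.mem_nhds (Metric.ball_subset_ball (by linarith) hw)))
          norm_deriv_le (Metric.ball_subset_ball (by linarith [norm_nonneg c]) hz')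
          (add_mem_ball_of_mem_ball_sub hz')
    _ = A * (‖c‖ / ρ) := by rw [add_sub_cancel_left]; ring

theorem differentiableOn_and_norm_fwdDiff_iter_le (hρ : 0 < ρ)
    (hd : DifferentiableOn ℂ h (Metric.ball x R)) (hA : ∀ z ∈ Metric.ball x R, ‖h z‖ ≤ A)
    (N : ℕ) :
    DifferentiableOn ℂ ((fwdDiff c)^[N] h) (Metric.ball x (R - N * (ρ + ‖c‖))) ∧
      ∀ z ∈ Metric.ball x (R - N * (ρ + ‖c‖)), ‖(fwdDiff c)^[N] h z‖ ≤ A * (‖c‖ / ρ) ^ N := by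
  induction N with
  | zero => simpa using ⟨hd, hA⟩
  | succ N ih =>
    have radius_eq : R - ↑(N + 1) * (ρ + ‖c‖) = R - N * (ρ + ‖c‖) - (ρ + ‖c‖) := by
      push_cast; ring
    simp only [Function.iterate_succ_apply', radius_eq, pow_succ, ← mul_assoc]
    exact ⟨(differentiableOn_fwdDiff_ball ih.1).mono (Metric.ball_subset_ball (by linarith)),
      fun z hz => norm_fwdDiff_le_of_differentiableOn hρ ih.1 ih.2 hz⟩

end Cauchy

/-! ### The terms of the lattice zeta series and their differences -/

/-- The term `k_μ^d |k|^(-s)` of a lattice zeta series. The term at `k = 0` is omitted, that is,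
set to `0`. -/
def latticeTerm (μ : Fin n) (d : ℕ) (s : ℂ) (k : Mode n) : ℂ :=
  if k = 0 then 0 else (k μ : ℂ) ^ d * (modeNorm k : ℂ) ^ (-s)

/-- The unit vector `e_i` of the lattice `ℤⁿ`. -/
abbrev unitMode (i : Fin n) : Mode n := Pi.single i 1

theorem norm_latticeTerm_le (μ : Fin n) (d : ℕ) (s : ℂ) (k : Mode n) :
    ‖latticeTerm μ d s k‖ ≤ modeNorm k ^ (d - s.re) := by
  unfold latticeTerm
  split_ifs with hk
  · simpa using Real.rpow_nonneg (modeNorm_nonneg k) _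
  · have hpos := modeNorm_pos hk
    rw [norm_mul, norm_pow, Complex.norm_cpow_eq_rpow_re_of_pos hpos, sub_eq_add_neg,
      Real.rpow_add hpos, Real.rpow_natCast, Complex.neg_re]
    gcongr
    simpa using abs_le_modeNorm k μ

theorem summable_norm_latticeTerm (μ : Fin n) (d : ℕ) {s : ℂ} (hs : n + d < s.re) :
    Summable fun k => ‖latticeTerm μ d s k‖ :=
  Summable.of_nonneg_of_le (fun _ => norm_nonneg _) (norm_latticeTerm_le μ d s)
    (summable_modeNorm_rpow (by linarith))

theorem differentiable_latticeTerm (μ : Fin n) (d : ℕ) (k : Mode n) :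
    Differentiable ℂ fun s => latticeTerm μ d s k := by
  unfold latticeTerm
  split_ifs with hk
  · fun_prop
  · have : (modeNorm k : ℂ) ≠ 0 := by exact_mod_cast (modeNorm_pos hk).ne'
    exact (differentiable_const _).mul fun s => differentiableAt_id.neg.const_cpow (Or.inl this)

theorem differentiable_fwdDiff_iter_latticeTerm (μ : Fin n) (d N : ℕ) (e k : Mode n) :
    Differentiable ℂ fun s => (fwdDiff e)^[N] (latticeTerm μ d s) k := by
  simp only [fwdDiff_iter_eq_sum_shift]
  exact Differentiable.fun_sum fun j _ => (differentiable_latticeTerm μ d _).const_smul _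

theorem modeNorm_add_smul_unitMode_sq (k : Mode n) (i : Fin n) (m : ℤ) :
    modeNorm (k + m • unitMode i) ^ 2 = modeNorm k ^ 2 + 2 * k i * m + m ^ 2 := by
  have add_sq_single (j : Fin n) : (((k + m • unitMode i) j : ℤ) : ℝ) ^ 2 =
      (k j : ℝ) ^ 2 + if j = i then 2 * (k i : ℝ) * m + (m : ℝ) ^ 2 else 0 := by
    rcases eq_or_ne j i with rfl | hj
    · simp
      ring
    · simp [hj]
  simp only [modeNorm_sq, add_sq_single, Finset.sum_add_distrib, Finset.sum_ite_eq',
    Finset.mem_univ, if_true, add_assoc]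

/-- The relative increment `(|k + z e_i|² - |k|²) / |k|²`, as a polynomial in the complex variable
`z`. -/
def relIncrement (i : Fin n) (k : Mode n) (z : ℂ) : ℂ :=
  (2 * k i * z + z ^ 2) / (modeNorm k : ℂ) ^ 2

/-- The holomorphic extension of `z ↦ latticeTerm μ d s (k + z e_i)` from the integers `z` with
`|z| < |k| / 4` to the disc of radius `|k| / 4`. -/
def latticeExt (μ i : Fin n) (d : ℕ) (s : ℂ) (k : Mode n) (z : ℂ) : ℂ :=
  (k μ + Pi.single (M := fun _ => ℂ) i z μ) ^ d *
    ((modeNorm k : ℂ) ^ (-s) * (1 + relIncrement i k z) ^ (-s / 2))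

theorem norm_relIncrement_le (i : Fin n) {k : Mode n} {z : ℂ} (hz : ‖z‖ < modeNorm k / 4) :
    ‖relIncrement i k z‖ ≤ 3 / 4 := by
  have hk : 0 < modeNorm k := by linarith [norm_nonneg z]
  have hki : ‖(k i : ℂ)‖ ≤ modeNorm k := by simpa using abs_le_modeNorm k i
  rw [relIncrement, norm_div, norm_pow, Complex.norm_real, Real.norm_of_nonneg hk.le,
    div_le_iff₀ (by positivity)]
  calc ‖2 * (k i : ℂ) * z + z ^ 2‖ ≤ 2 * ‖(k i : ℂ)‖ * ‖z‖ + ‖z‖ ^ 2 :=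
        (norm_add_le _ _).trans_eq (by simp)
    _ ≤ 2 * modeNorm k * (modeNorm k / 4) + (modeNorm k / 4) ^ 2 := by gcongr
    _ ≤ 3 / 4 * modeNorm k ^ 2 := by linarith [sq_nonneg (modeNorm k)]

theorem latticeTerm_add_smul_unitMode (μ i : Fin n) (d : ℕ) (s : ℂ) {k : Mode n} {m : ℤ}
    (hm : ‖(m : ℂ)‖ < modeNorm k / 4) :
    latticeTerm μ d s (k + m • unitMode i) = latticeExt μ i d s k m := by
  set l := k + m • unitMode i with hl
  set u : ℝ := (2 * k i * m + m ^ 2) / modeNorm k ^ 2 with hu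
  have hk : 0 < modeNorm k := by linarith [norm_nonneg (m : ℂ)]
  have relIncrement_eq : relIncrement i k m = (u : ℂ) := by simp [relIncrement, hu]
  have hu_pos : 0 < 1 + u := by
    have := norm_relIncrement_le i hm
    rw [relIncrement_eq, Complex.norm_real, Real.norm_eq_abs] at this
    linarith [(abs_le.mp this).1]
  have hl_sq : modeNorm l ^ 2 = modeNorm k ^ 2 * (1 + u) := by
    rw [modeNorm_add_smul_unitMode_sq, hu]
    field_simp
    ring
  have hl_norm : modeNorm l = modeNorm k * (1 + u) ^ (1 / 2 : ℝ) := by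
    rw [← Real.sqrt_eq_rpow, ← Real.sqrt_sq (modeNorm_nonneg l), hl_sq,
      Real.sqrt_mul (sq_nonneg _), Real.sqrt_sq hk.le]
  have hl_ne : l ≠ 0 := by
    intro h
    have : 0 < modeNorm l ^ 2 := by rw [hl_sq]; positivity
    simp [h, modeNorm] at this
  have coord_eq : (l μ : ℂ) = k μ + Pi.single (M := fun _ => ℂ) i (m : ℂ) μ := by
    rcases eq_or_ne μ i with rfl | hμ <;> simp [*]
  rw [latticeTerm, if_neg hl_ne, latticeExt, coord_eq, relIncrement_eq, hl_norm, Complex.ofReal_mul,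
    Complex.mul_cpow_ofReal_nonneg hk.le (by positivity),
    ← Complex.cpow_mul_ofReal_nonneg hu_pos.le]
  push_cast
  ring_nf

theorem differentiableOn_latticeExt (μ i : Fin n) (d : ℕ) (s : ℂ) (k : Mode n) :
    DifferentiableOn ℂ (latticeExt μ i d s k) (Metric.ball 0 (modeNorm k / 4)) := by
  refine DifferentiableOn.mul (DifferentiableOn.pow ?_ d)
    (DifferentiableOn.const_mul (DifferentiableOn.cpow_const ?_ fun z hz => ?_) _)
  · rcases eq_or_ne μ i with rfl | hμ
    · simp only [Pi.single_eq_same]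
      fun_prop
    · simp only [Pi.single_eq_of_ne hμ]
      fun_prop
  · unfold relIncrement
    fun_prop
  · refine Complex.mem_slitPlane_of_norm_lt_one
      ((norm_relIncrement_le i ?_).trans_lt (by norm_num))
    simpa using hz

theorem norm_one_add_cpow_le {u : ℂ} (hu : ‖u‖ ≤ 3 / 4) (a : ℂ) :
    ‖(1 + u) ^ a‖ ≤ Real.exp (2 * ‖a‖) := by
  have one_add_ne : 1 + u ≠ 0 := Complex.slitPlane_ne_zero
    (Complex.mem_slitPlane_of_norm_lt_one (hu.trans_lt (by norm_num)))
  have norm_log_le : ‖Complex.log (1 + u)‖ ≤ 2 := by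
    have inv_le : (1 - ‖u‖)⁻¹ ≤ 4 := inv_le_of_inv_le₀ (by norm_num) (by linarith)
    calc ‖Complex.log (1 + u)‖ ≤ ‖u‖ ^ 2 * (1 - ‖u‖)⁻¹ / 2 + ‖u‖ :=
          Complex.norm_log_one_add_le (hu.trans_lt (by norm_num))
      _ ≤ (3 / 4) ^ 2 * 4 / 2 + 3 / 4 := by
          gcongr
          exact inv_nonneg.mpr (by linarith)
      _ ≤ 2 := by norm_num
  rw [Complex.cpow_def_of_ne_zero one_add_ne]
  refine (Complex.norm_exp_le_exp_norm _).trans (Real.exp_le_exp.mpr ?_)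
  rw [norm_mul]
  gcongr

theorem norm_latticeExt_le (μ i : Fin n) (d : ℕ) (s : ℂ) {k : Mode n} {z : ℂ}
    (hz : ‖z‖ < modeNorm k / 4) :
    ‖latticeExt μ i d s k z‖ ≤ 2 ^ d * Real.exp ‖s‖ * modeNorm k ^ (d - s.re) := by
  have hk : 0 < modeNorm k := by linarith [norm_nonneg z]
  have norm_coord_le : ‖(k μ : ℂ) + Pi.single (M := fun _ => ℂ) i z μ‖ ≤ 2 * modeNorm k := by
    have hkμ : ‖(k μ : ℂ)‖ ≤ modeNorm k := by simpa using abs_le_modeNorm k μ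
    have norm_single_le : ‖Pi.single (M := fun _ => ℂ) i z μ‖ ≤ ‖z‖ := by
      rcases eq_or_ne μ i with rfl | hμ <;> simp [*]
    linarith [norm_add_le (k μ : ℂ) (Pi.single (M := fun _ => ℂ) i z μ)]
  have norm_cpow_le : ‖(1 + relIncrement i k z) ^ (-s / 2)‖ ≤ Real.exp ‖s‖ := by
    simpa [mul_div_cancel₀] using norm_one_add_cpow_le (norm_relIncrement_le i hz) (-s / 2)
  rw [latticeExt, norm_mul, norm_mul, norm_pow, Complex.norm_cpow_eq_rpow_re_of_pos hk,
    Complex.neg_re]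
  calc ‖(k μ : ℂ) + Pi.single (M := fun _ => ℂ) i z μ‖ ^ d *
        (modeNorm k ^ (-s.re) * ‖(1 + relIncrement i k z) ^ (-s / 2)‖)
      ≤ (2 * modeNorm k) ^ d * (modeNorm k ^ (-s.re) * Real.exp ‖s‖) := by gcongr
    _ = 2 ^ d * Real.exp ‖s‖ * modeNorm k ^ (d - s.re) := by
        rw [sub_eq_add_neg, Real.rpow_add hk, Real.rpow_natCast]
        ring

theorem norm_fwdDiff_iter_latticeTerm_le (μ i : Fin n) (d N : ℕ) (s : ℂ) {k : Mode n}
    (hk : 8 * (N + 1) ≤ modeNorm k) :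
    ‖(fwdDiff (-unitMode i))^[N] (latticeTerm μ d s) k‖ ≤
      2 ^ d * Real.exp ‖s‖ * (8 * (N + 1)) ^ N * modeNorm k ^ (d - s.re - N) := by
  have hpos : 0 < modeNorm k := lt_of_lt_of_le (by positivity) hk
  set ρ := modeNorm k / (8 * (N + 1)) with hρ
  have fwdDiff_eq : (fwdDiff (-unitMode i))^[N] (latticeTerm μ d s) k =
      (fwdDiff (-1 : ℂ))^[N] (latticeExt μ i d s k) 0 := by
    simp only [fwdDiff_iter_eq_sum_shift]
    refine Finset.sum_congr rfl fun j hj => ?_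
    have hj : (j : ℝ) ≤ N := by exact_mod_cast Nat.lt_succ_iff.mp (Finset.mem_range.mp hj)
    rw [show k + j • -unitMode i = k + (-j : ℤ) • unitMode i by simp,
      latticeTerm_add_smul_unitMode μ i d s (by simpa using by linarith)]
    simp
  have zero_mem_ball : (0 : ℂ) ∈ Metric.ball 0 (modeNorm k / 4 - N * (ρ + ‖(-1 : ℂ)‖)) := by
    have : N * ρ ≤ modeNorm k / 8 := by
      rw [hρ, mul_div_assoc', div_le_div_iff₀ (by positivity) (by norm_num)]
      nlinarith
    rw [Metric.mem_ball, dist_self, norm_neg, norm_one]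
    linarith
  rw [fwdDiff_eq]
  refine ((differentiableOn_and_norm_fwdDiff_iter_le (by positivity)
    (differentiableOn_latticeExt μ i d s k)
    (fun z hz => norm_latticeExt_le μ i d s (by simpa using hz)) N).2 0 zero_mem_ball).trans_eq ?_
  rw [Real.rpow_sub hpos (d - s.re) N, Real.rpow_natCast, hρ, norm_neg, norm_one, one_div_div,
    div_pow]
  ring

/-! ### Summation by parts -/

section SummationByParts

variable {G A : Type*} [AddCommGroup G] [NormedRing A] {v f : G → A} {C : ℝ}

theorem norm_fwdDiff_iter_le_of_norm_le (e : G) (N : ℕ) (hv : ∀ k, ‖v k‖ ≤ C) (k : G) :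
    ‖(fwdDiff e)^[N] v k‖ ≤ 2 ^ N * C := by
  induction N generalizing k with
  | zero => simpa using hv k
  | succ N ih =>
    rw [Function.iterate_succ_apply', pow_succ]
    exact (norm_sub_le _ _).trans ((add_le_add (ih _) (ih _)).trans_eq (by ring))

theorem summable_norm_fwdDiff_iter (e : G) (hf : Summable fun k => ‖f k‖) (N : ℕ) :
    Summable fun k => ‖(fwdDiff e)^[N] f k‖ := by
  induction N with
  | zero => exact hf
  | succ N ih =>
    rw [Function.iterate_succ_apply']
    exact Summable.of_nonneg_of_le (fun _ => norm_nonneg _) (fun _ => norm_sub_le _ _)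
      ((ih.comp_injective (add_left_injective e)).add ih)

variable [CompleteSpace A]

theorem summable_mul_of_norm_le {ι : Type*} {v f : ι → A} (hv : ∀ k, ‖v k‖ ≤ C)
    (hf : Summable fun k => ‖f k‖) : Summable fun k => v k * f k :=
  (hf.mul_left C).of_norm_bounded fun k =>
    (norm_mul_le _ _).trans (mul_le_mul_of_nonneg_right (hv k) (norm_nonneg _))

theorem tsum_fwdDiff_mul (e : G) (hv : ∀ k, ‖v k‖ ≤ C) (hf : Summable fun k => ‖f k‖) :
    ∑' k, fwdDiff e v k * f k = ∑' k, v k * fwdDiff (-e) f k := by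
  have summable_mul : Summable fun k => v k * f k := summable_mul_of_norm_le hv hf
  have summable_shift_mul : Summable fun k => v (k + e) * f k :=
    summable_mul_of_norm_le (v := fun k => v (k + e)) (fun k => hv _) hf
  have summable_mul_shift : Summable fun k => v k * f (k + -e) :=
    summable_mul_of_norm_le hv (hf.comp_injective (add_left_injective (-e)))
  simp only [fwdDiff, sub_mul, mul_sub]
  rw [summable_shift_mul.tsum_sub summable_mul, summable_mul_shift.tsum_sub summable_mul,
    ← (Equiv.addRight (-e)).tsum_eq fun k => v (k + e) * f k]
  simp

theorem tsum_fwdDiff_iter_mul (e : G) (N : ℕ) (hv : ∀ k, ‖v k‖ ≤ C)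
    (hf : Summable fun k => ‖f k‖) :
    ∑' k, (fwdDiff e)^[N] v k * f k = ∑' k, v k * (fwdDiff (-e))^[N] f k := by
  induction N generalizing v C with
  | zero => rfl
  | succ N ih =>
    have hv' : ∀ k, ‖fwdDiff e v k‖ ≤ 2 ^ 1 * C := norm_fwdDiff_iter_le_of_norm_le e 1 hv
    rw [Function.iterate_succ_apply, ih hv', Function.iterate_succ_apply',
      tsum_fwdDiff_mul e hv (summable_norm_fwdDiff_iter (-e) hf N)]

end SummationByParts

/-! ### Entire continuation of lattice zeta series -/

theorem exists_summable_norm_fwdDiff_iter_latticeTerm_le (μ i : Fin n) (d N : ℕ) {a b : ℝ}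
    (ha : n + d - N < a) :
    ∃ u : Mode n → ℝ, Summable u ∧ ∀ k, ∀ s : ℂ, a ≤ s.re → ‖s‖ ≤ b →
      ‖(fwdDiff (-unitMode i))^[N] (latticeTerm μ d s) k‖ ≤ u k := by
  have exists_bound (k : Mode n) : ∃ M : ℝ, ∀ s ∈ Metric.closedBall (0 : ℂ) b,
      ‖(fwdDiff (-unitMode i))^[N] (latticeTerm μ d s) k‖ ≤ M :=
    (isCompact_closedBall 0 b).exists_bound_of_continuousOn
      (differentiable_fwdDiff_iter_latticeTerm μ d N _ k).continuous.continuousOn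
  choose M hM using exists_bound
  set u : Mode n → ℝ := fun k =>
    2 ^ d * Real.exp b * (8 * (N + 1)) ^ N * modeNorm k ^ (d - a - N)
  refine ⟨fun k => if 8 * (N + 1) ≤ modeNorm k then u k else M k, ?_, fun k s hs hb => ?_⟩
  · refine (summable_congr_cofinite (g := u) ?_).mpr
      ((summable_modeNorm_rpow (by linarith)).mul_left _)
    refine (finite_setOf_modeNorm_lt n (8 * (N + 1))).subset fun k hk => ?_
    by_contra h
    exact hk (if_pos (not_lt.mp h))
  · dsimp only
    split_ifs with hk
    · refine (norm_fwdDiff_iter_latticeTerm_le μ i d N s hk).trans ?_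
      have : 1 ≤ modeNorm k := le_trans (by linarith [N.cast_nonneg (α := ℝ)]) hk
      dsimp only [u]
      gcongr
    · exact hM k s (by simpa using hb)

theorem differentiableOn_tsum_mul_fwdDiff_iter_latticeTerm (μ i : Fin n) (d N : ℕ)
    {v : Mode n → ℂ} {C : ℝ} (hv : ∀ k, ‖v k‖ ≤ C) :
    DifferentiableOn ℂ (fun s => ∑' k, v k * (fwdDiff (-unitMode i))^[N] (latticeTerm μ d s) k)
      {s | n + d - N < s.re} := by
  intro s₀ hs₀
  obtain ⟨a, ha, has₀⟩ := exists_between (Set.mem_ofPred_eq ▸ hs₀)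
  obtain ⟨u, hu, hle⟩ :=
    exists_summable_norm_fwdDiff_iter_latticeTerm_le μ i d N (b := ‖s₀‖ + 1) ha
  set U : Set ℂ := {s | a < s.re} ∩ Metric.ball 0 (‖s₀‖ + 1)
  have isOpen_U : IsOpen U :=
    (isOpen_lt continuous_const Complex.continuous_re).inter Metric.isOpen_ball
  have mem_U : s₀ ∈ U := ⟨has₀, by simp⟩
  have differentiableOn_U := Complex.differentiableOn_tsum_of_summable_norm (hu.mul_left C)
    (F := fun k s => v k * (fwdDiff (-unitMode i))^[N] (latticeTerm μ d s) k)
    (fun k => ((differentiable_fwdDiff_iter_latticeTerm μ d N _ k).const_mul _).differentiableOn)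
    isOpen_U fun k s hs => by
      have hs_norm : ‖s‖ < ‖s₀‖ + 1 := by simpa using hs.2
      rw [norm_mul]
      exact mul_le_mul (hv k) (hle k s (le_of_lt hs.1) hs_norm.le) (norm_nonneg _)
        ((norm_nonneg _).trans (hv k))
  exact (differentiableOn_U.differentiableAt (isOpen_U.mem_nhds mem_U)).differentiableWithinAt

theorem exists_entire_of_differentiableOn_halfPlanes {a : ℝ} {f : ℂ → ℂ} {F : ℕ → ℂ → ℂ}
    (hF : ∀ N, DifferentiableOn ℂ (F N) {s | a - N < s.re})
    (hf : ∀ N s, a < s.re → F N s = f s) :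
    ∃ G : ℂ → ℂ, Differentiable ℂ G ∧ ∀ s : ℂ, a < s.re → G s = f s := by
  have isOpen_halfPlane (b : ℝ) : IsOpen {s : ℂ | b < s.re} :=
    isOpen_lt continuous_const Complex.continuous_re
  have halfPlane_subset {M N : ℕ} (h : M ≤ N) :
      {s : ℂ | a - M < s.re} ⊆ {s : ℂ | a - N < s.re} :=
    fun s (hs : a - M < s.re) => lt_of_le_of_lt (by gcongr) hs
  have eqOn_halfPlane {M N : ℕ} (h : M ≤ N) : Set.EqOn (F M) (F N) {s | a - M < s.re} := by
    refine AnalyticOnNhd.eqOn_of_preconnected_of_eventuallyEq (z₀ := ((a + 1 : ℝ) : ℂ))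
      ((hF M).analyticOnNhd (isOpen_halfPlane _))
      (((hF N).mono (halfPlane_subset h)).analyticOnNhd (isOpen_halfPlane _))
      (convex_halfSpace_re_gt _).isPreconnected ?_ ?_
    · rw [Set.mem_ofPred_eq, Complex.ofReal_re]
      linarith [M.cast_nonneg (α := ℝ)]
    · filter_upwards [(isOpen_halfPlane a).mem_nhds (by simp : ((a + 1 : ℝ) : ℂ) ∈ _)] with s hs
      rw [hf M s hs, hf N s hs]
  have exists_mem_halfPlane (s : ℂ) : ∃ N : ℕ, a - N < s.re :=
    (exists_nat_gt (a - s.re)).imp fun N hN => by linarith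
  choose ν hν using exists_mem_halfPlane
  have apply_ν_eq (N : ℕ) (s : ℂ) (hs : a - N < s.re) : F (ν s) s = F N s :=
    (le_total (ν s) N).elim (fun h => eqOn_halfPlane h (hν s)) fun h => (eqOn_halfPlane h hs).symm
  refine ⟨fun s => F (ν s) s, fun s => ?_, fun s hs => hf _ s hs⟩
  have nhds_s := (isOpen_halfPlane (a - ν s)).mem_nhds (hν s)
  exact ((hF (ν s)).differentiableAt nhds_s).congr_of_eventuallyEq
    (Filter.mem_of_superset nhds_s fun z hz => apply_ν_eq _ z hz)

/-- A function on the lattice is difference exact if, for every `N`, it is a sum of `N`-th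
differences of bounded functions in the coordinate directions. The zeta series with such a weight
converges after sufficiently many summations by parts. -/
def IsDiffExact (w : Mode n → ℂ) : Prop :=
  ∀ N : ℕ, ∃ v : Fin n → Mode n → ℂ, (∃ C : ℝ, ∀ i k, ‖v i k‖ ≤ C) ∧
    ∀ k, w k = ∑ i, (fwdDiff (unitMode i))^[N] (v i) k

theorem IsDiffExact.exists_entire {w : Mode n → ℂ} (hw : IsDiffExact w) (μ : Fin n) (d : ℕ) :
    ∃ G : ℂ → ℂ, Differentiable ℂ G ∧
      ∀ s : ℂ, n + d < s.re → G s = ∑' k, w k * latticeTerm μ d s k := by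
  choose v hv hwv using hw
  refine exists_entire_of_differentiableOn_halfPlanes
    (F := fun N s => ∑ i, ∑' k, v N i k * (fwdDiff (-unitMode i))^[N] (latticeTerm μ d s) k)
    (fun N => ?_) fun N s hs => ?_
  · obtain ⟨C, hC⟩ := hv N
    exact DifferentiableOn.fun_sum fun i _ =>
      differentiableOn_tsum_mul_fwdDiff_iter_latticeTerm μ i d N (hC i)
  · obtain ⟨C, hC⟩ := hv N
    have hsum := summable_norm_latticeTerm μ d hs
    simp only [hwv N, Finset.sum_mul]
    rw [Summable.tsum_finsetSum fun i _ => summable_mul_of_norm_le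
      (norm_fwdDiff_iter_le_of_norm_le _ N (hC i)) hsum]
    exact Finset.sum_congr rfl fun i _ => (tsum_fwdDiff_iter_mul _ N (hC i) hsum).symm

/-! ### Series of characters of the lattice -/

theorem fwdDiff_iter_tsum {G A ι : Type*} [AddCommGroup G] [AddCommGroup A] [TopologicalSpace A]
    [IsTopologicalAddGroup A] [T2Space A] {f : ι → G → A} (hf : ∀ k, Summable fun t => f t k)
    (e : G) (N : ℕ) (k : G) :
    (fwdDiff e)^[N] (fun k => ∑' t, f t k) k = ∑' t, (fwdDiff e)^[N] (f t) k := by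
  simp only [fwdDiff_iter_eq_sum_shift]
  rw [Summable.tsum_finsetSum fun m _ => (hf _).const_smul _]
  exact Finset.sum_congr rfl fun m _ => ((hf _).tsum_const_smul _).symm

theorem fwdDiff_iter_mul_circleChar {G : Type*} [AddCommGroup G] (c : ℂ) (χ : AddChar G Circle)
    (e : G) (N : ℕ) (k : G) :
    (fwdDiff e)^[N] (fun k => c * (χ k : ℂ)) k = c * (((χ e : ℂ) - 1) ^ N * χ k) :=
  (congrFun (fwdDiff_iter_const_smul e c (Circle.coeHom.compAddChar χ) N) k).trans
    (congrArg (c * ·) (fwdDiff_addChar_eq (Circle.coeHom.compAddChar χ) k e N))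

theorem summable_mul_circleChar {G ι : Type*} [AddCommGroup G] {c : ι → ℂ}
    (hc : Summable fun t => ‖c t‖) (χ : ι → AddChar G Circle) (k : G) :
    Summable fun t => c t * (χ t k : ℂ) :=
  hc.of_norm_bounded fun t => by rw [norm_mul, Circle.norm_coe, mul_one]

theorem norm_tsum_mul_circleChar_le {G ι : Type*} [AddCommGroup G] {c : ι → ℂ}
    (hc : Summable fun t => ‖c t‖) (χ : ι → AddChar G Circle) (k : G) :
    ‖∑' t, c t * (χ t k : ℂ)‖ ≤ ∑' t, ‖c t‖ :=
  tsum_of_norm_bounded hc.hasSum fun t => by rw [norm_mul, Circle.norm_coe, mul_one]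

theorem isDiffExact_tsum_mul_circleChar {ι : Type*} {χ : ι → AddChar (Mode n) Circle} {c : ι → ℂ}
    (j : ι → Fin n) (hj : ∀ t, χ t (unitMode (j t)) ≠ 1)
    (hc : ∀ N : ℕ, Summable fun t => ‖c t‖ / ‖(χ t (unitMode (j t)) : ℂ) - 1‖ ^ N) :
    IsDiffExact fun k => ∑' t, c t * χ t k := by
  intro N
  set b : Fin n → ι → ℂ := fun i t =>
    if j t = i then c t / ((χ t (unitMode (j t)) : ℂ) - 1) ^ N else 0
  have summable_b (i : Fin n) : Summable fun t => ‖b i t‖ := by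
    refine Summable.of_nonneg_of_le (fun _ => norm_nonneg _) (fun t => ?_) (hc N)
    dsimp only [b]
    split_ifs
    · simp
    · simpa using div_nonneg (norm_nonneg (c t)) (pow_nonneg (norm_nonneg _) N)
  have fwdDiff_term (i : Fin n) (t : ι) (k : Mode n) :
      (fwdDiff (unitMode i))^[N] (fun k => b i t * χ t k) k =
        if j t = i then c t * χ t k else 0 := by
    rw [fwdDiff_iter_mul_circleChar]
    dsimp only [b]
    split_ifs with h
    · subst h
      have : (χ t (unitMode (j t)) : ℂ) - 1 ≠ 0 :=
        sub_ne_zero.mpr fun h => hj t (Circle.coe_eq_one.mp h)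
      field_simp
    · simp
  refine ⟨fun i k => ∑' t, b i t * χ t k, ⟨∑ i, ∑' t, ‖b i t‖, fun i k => ?_⟩, fun k => ?_⟩
  · exact (norm_tsum_mul_circleChar_le (summable_b i) χ k).trans
      (Finset.single_le_sum (f := fun i => ∑' t, ‖b i t‖)
        (fun i _ => tsum_nonneg fun t => norm_nonneg _) (Finset.mem_univ i))
  · simp only [fwdDiff_iter_tsum (fun k => summable_mul_circleChar (summable_b _) χ k),
      fwdDiff_term]
    have summable_c : Summable fun t => ‖c t‖ := by simpa using hc 0
    rw [← Summable.tsum_finsetSum fun i _ => summable_c.of_norm_bounded fun t => ?_]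
    · simp
    · split_ifs
      · rw [norm_mul, Circle.norm_coe, mul_one]
      · simp

/-! ### The lattice zeta function -/

/-- The character `k ↦ (-1)^(k_i)` of the lattice. -/
def parityChar (i : Fin n) : AddChar (Mode n) Circle where
  toFun k := (-1) ^ k i
  map_zero_eq_one' := by simp
  map_add_eq_mul' k l := by simp [zpow_add]

theorem sum_prod_parityChar (k : Mode n) :
    ∑ t : Finset (Fin n), ((∏ i ∈ t, parityChar i) k : ℂ) =
      if ∀ i, Even (k i) then 2 ^ n else 0 := by
  have sum_eq_prod : ∑ t : Finset (Fin n), ((∏ i ∈ t, parityChar i) k : ℂ) =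
      ∏ i, (1 + (-1 : ℂ) ^ k i) := by
    rw [Finset.prod_one_add, Finset.powerset_univ]
    refine Finset.sum_congr rfl fun t _ => ?_
    rw [AddChar.prod_apply]
    exact (map_prod Circle.coeHom _ _).trans (Finset.prod_congr rfl fun i _ => rfl)
  rw [sum_eq_prod]
  split_ifs with h
  · simp [(h _).neg_one_zpow, one_add_one_eq_two]
  · obtain ⟨i, hi⟩ := not_forall.mp h
    exact Finset.prod_eq_zero (Finset.mem_univ i) (by
      rw [(Int.not_even_iff_odd.mp hi).neg_one_zpow, add_neg_cancel])

theorem isDiffExact_sum_prod_parityChar (n : ℕ) :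
    IsDiffExact fun k : Mode n =>
      ∑ t : {t : Finset (Fin n) // t ≠ ∅}, ((∏ i ∈ t.1, parityChar i) k : ℂ) := by
  choose j hj using fun t : {t : Finset (Fin n) // t ≠ ∅} => Finset.nonempty_iff_ne_empty.mpr t.2
  have apply_unitMode (t : {t : Finset (Fin n) // t ≠ ∅}) :
      (∏ i ∈ t.1, parityChar i) (unitMode (j t)) = -1 := by
    rw [AddChar.prod_apply, Finset.prod_eq_single_of_mem _ (hj t) fun i _ hi => by
      simp [parityChar, hi]]
    simp [parityChar]
  simpa using isDiffExact_tsum_mul_circleChar (c := 1)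
    (χ := fun t : {t : Finset (Fin n) // t ≠ ∅} => ∏ i ∈ t.1, parityChar i)
    j (fun t => by
      rw [apply_unitMode]
      exact Circle.neg_ne_self 1) fun N => (hasSum_fintype _).summable

theorem latticeTerm_two_nsmul (μ : Fin n) (d : ℕ) (s : ℂ) (k : Mode n) :
    latticeTerm μ d s (2 • k) = (2 : ℂ) ^ (d - s) * latticeTerm μ d s k := by
  have modeNorm_two_nsmul : modeNorm (2 • k) = 2 * modeNorm k := by
    rw [← sq_eq_sq₀ (modeNorm_nonneg _) (mul_nonneg zero_le_two (modeNorm_nonneg k)), mul_pow,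
      modeNorm_sq, modeNorm_sq, Finset.mul_sum]
    simp [mul_pow]
  simp only [latticeTerm, smul_eq_zero_iff_right two_ne_zero]
  split_ifs with hk
  · simp
  · rw [modeNorm_two_nsmul, Complex.ofReal_mul,
      Complex.mul_cpow_ofReal_nonneg zero_le_two (modeNorm_nonneg k), sub_eq_add_neg,
      Complex.cpow_add _ _ two_ne_zero, Complex.cpow_natCast]
    simp [mul_pow]
    ring

/-- The indicator function of `2ℤⁿ` is `2⁻ⁿ` times the sum of the parity characters; the trivial
one among them contributes the zeta series itself, and the restriction to `2ℤⁿ` rescales it. -/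
theorem tsum_sum_prod_parityChar_mul_latticeTerm (μ : Fin n) (d : ℕ) {s : ℂ}
    (hs : n + d < s.re) :
    ∑' k, (∑ t : {t : Finset (Fin n) // t ≠ ∅}, ((∏ i ∈ t.1, parityChar i) k : ℂ)) *
        latticeTerm μ d s k =
      ((2 : ℂ) ^ (n + d - s) - 1) * ∑' k, latticeTerm μ d s k := by
  have sum_nonempty_eq (k : Mode n) :
      ∑ t : {t : Finset (Fin n) // t ≠ ∅}, ((∏ i ∈ t.1, parityChar i) k : ℂ) =
        (if ∀ i, Even (k i) then 2 ^ n else 0) - 1 := by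
    rw [← sum_prod_parityChar, Fintype.sum_eq_add_sum_subtype_ne (α := Finset (Fin n)) _ ∅]
    simp
  have summable_term := (summable_norm_latticeTerm μ d hs).of_norm
  have injective_two_nsmul : Function.Injective fun k : Mode n => 2 • k :=
    smul_right_injective _ two_ne_zero
  have tsum_even : ∑' k, (if ∀ i, Even (k i) then 2 ^ n else 0) * latticeTerm μ d s k =
      (2 : ℂ) ^ (n + d - s) * ∑' k, latticeTerm μ d s k := by
    rw [← injective_two_nsmul.tsum_eq, ← tsum_mul_left]
    · refine tsum_congr fun k => ?_
      rw [if_pos fun i => by simp, latticeTerm_two_nsmul, add_sub_assoc,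
        Complex.cpow_add _ _ two_ne_zero, Complex.cpow_natCast, mul_assoc]
    · intro k hk
      have : ∀ i, Even (k i) := by
        by_contra h
        simp [h] at hk
      choose j hj using fun i => (this i).two_dvd
      exact ⟨j, funext fun i => by simp [hj i]⟩
  simp only [sum_nonempty_eq, sub_mul, one_mul]
  rw [Summable.tsum_sub _ summable_term, tsum_even]
  exact summable_mul_of_norm_le (C := 2 ^ n) (fun k => by split_ifs <;> simp) summable_term.norm

/-- The series `∑ᵢ f s i` converges for `Re s` large, and its sum has a meromorphic continuation to
the complex plane which is analytic at `z₀`. -/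
def HasMeromorphicSum {ι : Type*} (f : ℂ → ι → ℂ) (z₀ : ℂ) : Prop :=
  ∃ (F : ℂ → ℂ) (R : ℝ), Meromorphic F ∧ AnalyticAt ℂ F z₀ ∧
    ∀ s : ℂ, R < s.re → HasSum (f s) (F s)

namespace HasMeromorphicSum

variable {ι : Type*} {f g : ℂ → ι → ℂ} {z₀ : ℂ}

theorem of_hasSum_const {a : ι → ℂ} {b : ℂ} (h : HasSum a b) : HasMeromorphicSum (fun _ => a) z₀ :=
  ⟨fun _ => b, 0, fun s => MeromorphicAt.const b s, analyticAt_const, fun _ _ => h⟩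

theorem add (hf : HasMeromorphicSum f z₀) (hg : HasMeromorphicSum g z₀) :
    HasMeromorphicSum (fun s i => f s i + g s i) z₀ := by
  obtain ⟨F, R, hF, hF₀, hFf⟩ := hf
  obtain ⟨G, R', hG, hG₀, hGg⟩ := hg
  exact ⟨F + G, max R R', hF.add hG, hF₀.add hG₀, fun s hs =>
    (hFf s ((le_max_left _ _).trans_lt hs)).add (hGg s ((le_max_right _ _).trans_lt hs))⟩

theorem finset_sum {κ : Type*} {t : Finset κ} {f : κ → ℂ → ι → ℂ}
    (hf : ∀ j ∈ t, HasMeromorphicSum (f j) z₀) :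
    HasMeromorphicSum (fun s i => ∑ j ∈ t, f j s i) z₀ := by
  classical
  induction t using Finset.induction_on with
  | empty => simpa using of_hasSum_const hasSum_zero
  | insert j t hj ih =>
    simp only [Finset.sum_insert hj]
    exact (hf j (t.mem_insert_self j)).add (ih fun i hi => hf i (Finset.mem_insert_of_mem hi))

theorem const_mul (c : ℂ) (hf : HasMeromorphicSum f z₀) :
    HasMeromorphicSum (fun s i => c * f s i) z₀ := by
  obtain ⟨F, R, hF, hF₀, hFf⟩ := hf
  exact ⟨fun s => c * F s, R, fun s => (MeromorphicAt.const c s).mul (hF s),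
    analyticAt_const.mul hF₀, fun s hs => (hFf s hs).mul_left c⟩

theorem comp_add_const {a : ℂ} (hf : HasMeromorphicSum f (z₀ + a)) :
    HasMeromorphicSum (fun s => f (s + a)) z₀ := by
  obtain ⟨F, R, hF, hF₀, hFf⟩ := hf
  refine ⟨fun s => F (s + a), R - a.re, fun s =>
    meromorphicAt_fun_comp_add_const_iff_meromorphicAt.mpr (hF (s + a)), ?_, fun s hs =>
    hFf _ (by rw [Complex.add_re]; linarith)⟩
  exact hF₀.fun_comp_of_eq (by fun_prop) rfl

end HasMeromorphicSum

theorem IsDiffExact.exists_norm_le {w : Mode n → ℂ} (hw : IsDiffExact w) :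
    ∃ C : ℝ, ∀ k, ‖w k‖ ≤ C := by
  obtain ⟨v, ⟨C, hC⟩, hwv⟩ := hw 0
  exact ⟨∑ _i : Fin n, C, fun k => hwv k ▸ norm_sum_le_of_le _ fun i _ => hC i k⟩

theorem IsDiffExact.hasMeromorphicSum {w : Mode n → ℂ} (hw : IsDiffExact w) (μ : Fin n) (d : ℕ)
    (z₀ : ℂ) : HasMeromorphicSum (fun s k => w k * latticeTerm μ d s k) z₀ := by
  obtain ⟨G, hG, hGw⟩ := hw.exists_entire μ d
  obtain ⟨C, hC⟩ := hw.exists_norm_le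
  refine ⟨G, n + d, fun s => (hG.analyticAt s).meromorphicAt, hG.analyticAt z₀, fun s hs => ?_⟩
  rw [hGw s hs]
  exact (summable_mul_of_norm_le hC (summable_norm_latticeTerm μ d hs)).hasSum

theorem two_cpow_ne_one {z : ℂ} (hz : z.re ≠ 0) : (2 : ℂ) ^ z ≠ 1 := by
  intro h
  have := Complex.norm_cpow_eq_rpow_re_of_pos two_pos z
  rw [Complex.ofReal_ofNat, h, norm_one, ← Real.rpow_zero 2,
    Real.rpow_right_inj two_pos (by norm_num)] at this
  exact hz this.symm

theorem hasMeromorphicSum_latticeTerm (μ : Fin n) (d : ℕ) {z₀ : ℂ} (hz₀ : z₀.re ≠ n + d) :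
    HasMeromorphicSum (latticeTerm μ d) z₀ := by
  obtain ⟨G, hG, hGs⟩ := (isDiffExact_sum_prod_parityChar n).exists_entire μ d
  set q : ℂ → ℂ := fun s => (2 : ℂ) ^ (n + d - s) - 1
  have differentiable_q : Differentiable ℂ q := fun s =>
    (DifferentiableAt.const_cpow (by fun_prop) (Or.inl two_ne_zero)).sub_const 1
  have q_ne_zero {s : ℂ} (hs : s.re ≠ n + d) : q s ≠ 0 :=
    sub_ne_zero.mpr (two_cpow_ne_one (by simpa [sub_eq_zero] using hs.symm))
  refine ⟨fun s => G s / q s, n + d, fun s => ?_, ?_, fun s hs => ?_⟩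
  · exact (hG.analyticAt s).meromorphicAt.div (differentiable_q.analyticAt s).meromorphicAt
  · exact (hG.analyticAt z₀).div (differentiable_q.analyticAt z₀) (q_ne_zero hz₀)
  · dsimp only
    rw [hGs s hs, tsum_sum_prod_parityChar_mul_latticeTerm μ d hs,
      mul_div_cancel_left₀ _ (q_ne_zero hs.ne')]
    exact (summable_norm_latticeTerm μ d hs).of_norm.hasSum

theorem hasMeromorphicSum_mul_latticeTerm {w : Mode n → ℂ} {c : ℂ}
    (hw : IsDiffExact fun k => w k - c) (μ : Fin n) (d : ℕ) {z₀ : ℂ} (hz₀ : z₀.re ≠ n + d) :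
    HasMeromorphicSum (fun s k => w k * latticeTerm μ d s k) z₀ := by
  simpa [sub_mul] using
    (hw.hasMeromorphicSum μ d z₀).add ((hasMeromorphicSum_latticeTerm μ d hz₀).const_mul c)

/-! ### Rapidly decaying families -/

/-- The family `M`, indexed by the frequencies `g`, is summable against every power of
`1 + ‖g‖`. -/
def HasRapidDecay {ι E F : Type*} [Norm E] [Norm F] (g : ι → E) (M : ι → F) : Prop :=
  ∀ r : ℕ, Summable fun i => (1 + ‖g i‖) ^ r * ‖M i‖

namespace HasRapidDecay

variable {ι κ E E' F F' : Type*} [SeminormedAddGroup E] [SeminormedAddGroup E']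
  [SeminormedAddGroup F] [SeminormedAddGroup F'] {g : ι → E} {M : ι → F}

theorem summable_norm (h : HasRapidDecay g M) : Summable fun i => ‖M i‖ := by
  simpa using h 0

theorem of_norm_le {g' : ι → E'} {M' : ι → F'} {C : ℝ} {d : ℕ} (h : HasRapidDecay g M)
    (hg : ∀ i, ‖g' i‖ ≤ ‖g i‖) (hM : ∀ i, ‖M' i‖ ≤ C * (1 + ‖g i‖) ^ d * ‖M i‖) :
    HasRapidDecay g' M' := fun r => by
  refine Summable.of_nonneg_of_le (fun i => by positivity) (fun i => ?_) ((h (r + d)).mul_left C)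
  calc (1 + ‖g' i‖) ^ r * ‖M' i‖ ≤ (1 + ‖g i‖) ^ r * (C * (1 + ‖g i‖) ^ d * ‖M i‖) := by
        gcongr
        exacts [hg i, hM i]
    _ = C * ((1 + ‖g i‖) ^ (r + d) * ‖M i‖) := by ring

theorem comp_injective (h : HasRapidDecay g M) {e : κ → ι} (he : Function.Injective e) :
    HasRapidDecay (g ∘ e) (M ∘ e) := fun r =>
  (h r).comp_injective he

theorem sumElim {g' : κ → E} {M' : κ → F} (h : HasRapidDecay g M) (h' : HasRapidDecay g' M') :
    HasRapidDecay (Sum.elim g g') (Sum.elim M M') := fun r =>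
  (HasSum.sum (f := fun i => (1 + ‖Sum.elim g g' i‖) ^ r * ‖Sum.elim M M' i‖)
    (h r).hasSum (h' r).hasSum).summable

theorem add_mul {R : Type*} [SeminormedRing R] {M : ι → R} {g' : κ → E} {M' : κ → R}
    (h : HasRapidDecay g M) (h' : HasRapidDecay g' M') :
    HasRapidDecay (fun p : ι × κ => g p.1 + g' p.2) fun p => M p.1 * M' p.2 := fun r => by
  refine Summable.of_nonneg_of_le (fun p => by positivity) (fun p => ?_)
    ((h r).mul_of_nonneg (h' r) (fun _ => by positivity) (fun _ => by positivity))
  have one_add_norm_add_le : 1 + ‖g p.1 + g' p.2‖ ≤ (1 + ‖g p.1‖) * (1 + ‖g' p.2‖) := by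
    linarith [norm_add_le (g p.1) (g' p.2), mul_nonneg (norm_nonneg (g p.1)) (norm_nonneg (g' p.2))]
  calc (1 + ‖g p.1 + g' p.2‖) ^ r * ‖M p.1 * M' p.2‖
      ≤ ((1 + ‖g p.1‖) * (1 + ‖g' p.2‖)) ^ r * (‖M p.1‖ * ‖M' p.2‖) := by
        gcongr
        exact norm_mul_le _ _
    _ = (1 + ‖g p.1‖) ^ r * ‖M p.1‖ * ((1 + ‖g' p.2‖) ^ r * ‖M' p.2‖) := by
        rw [mul_pow, mul_mul_mul_comm]

end HasRapidDecay

theorem norm_le_modeNorm (k : Mode n) : ‖k‖ ≤ modeNorm k :=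
  (pi_norm_le_iff_of_nonneg (modeNorm_nonneg k)).mpr fun i => by
    simpa [Int.norm_eq_abs] using abs_le_modeNorm k i

theorem IsSchwartz.hasRapidDecay {a : Mode n → ℂ} (ha : IsSchwartz a) :
    HasRapidDecay (fun l => l) a := fun r => by
  set w : Mode n → ℂ := fun l => (1 + modeNorm l ^ 2 : ℝ) ^ r * a l with hw
  have norm_w (l : Mode n) : ‖w l‖ = (1 + modeNorm l ^ 2) ^ r * ‖a l‖ := by
    rw [hw, norm_mul, norm_pow, Complex.norm_real, Real.norm_of_nonneg (by positivity)]
  have isSchwartz_w : IsSchwartz w := fun t => (ha (t + 2 * r)).imp fun C hC k => by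
    rw [norm_w]
    exact (hC k).trans_eq' (by ring)
  refine Summable.of_nonneg_of_le (fun l => by positivity) (fun l => ?_)
    (isSchwartz_w.summable_norm.mul_left (2 ^ r))
  rw [norm_w, ← mul_assoc, ← mul_pow]
  gcongr
  nlinarith [norm_le_modeNorm l, sq_nonneg (modeNorm l - 1)]

/-! ### Twisted translations -/

section Pairing

variable (Θ : Matrix (Fin n) (Fin n) ℝ) (k l q : Mode n)

theorem pairing_add_left : pairing Θ (k + l) q = pairing Θ k q + pairing Θ l q := by
  simp only [pairing, Pi.add_apply, Int.cast_add, add_mul, Finset.sum_add_distrib]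

theorem pairing_add_right : pairing Θ k (l + q) = pairing Θ k l + pairing Θ k q := by
  simp only [pairing, Pi.add_apply, Int.cast_add, mul_add, Finset.sum_add_distrib]

/-- The character `k ↦ e^(-(i/2) l.Θk)` of the lattice. -/
def torusChar : AddChar (Mode n) Circle where
  toFun k := Circle.exp (-(pairing Θ l k / 2))
  map_zero_eq_one' := by simp [pairing]
  map_add_eq_mul' k q := by rw [pairing_add_right, add_div, neg_add, Circle.exp_add]

theorem torusChar_add : torusChar Θ (k + l) = torusChar Θ k * torusChar Θ l :=
  DFunLike.ext _ _ fun q => by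
    change Circle.exp _ = Circle.exp _ * Circle.exp _
    rw [pairing_add_left, add_div, neg_add, Circle.exp_add]

theorem torusChar_zero : torusChar Θ 0 = 1 :=
  DFunLike.ext _ _ fun q => by simp [torusChar, pairing]

theorem coe_torusChar :
    (torusChar Θ l k : ℂ) = Complex.exp (-(Complex.I / 2) * (pairing Θ l k : ℂ)) := by
  refine congrArg Complex.exp ?_
  push_cast
  ring

end Pairing

/-- The operator `U_r ⊗ v ↦ e^(-(i/2) (l - m).Θ(r + l + m)) U_(r + l + m) ⊗ M v`, where
`g = (l, m)`: up to a phase, left multiplication by `U_l` and right multiplication by `U_m`. -/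
def torusOp (Θ : Matrix (Fin n) (Fin n) ℝ) (g : Mode n × Mode n) (M : Spinor n →L[ℂ] Spinor n) :
    Hil n →L[ℂ] Hil n :=
  blockOp (Equiv.subRight (g.1 + g.2)) (fun k => (torusChar Θ (g.1 - g.2) k : ℂ) • M) ‖M‖
    fun k v => by
      rw [smul_apply, norm_smul, Circle.norm_coe, one_mul]
      exact M.le_opNorm v

section TorusOp

variable (Θ : Matrix (Fin n) (Fin n) ℝ) (g h : Mode n × Mode n) (M N : Spinor n →L[ℂ] Spinor n)

theorem torusOp_apply (ψ : Hil n) (k : Mode n) :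
    torusOp Θ g M ψ k = (torusChar Θ (g.1 - g.2) k : ℂ) • M (ψ (k - (g.1 + g.2))) := rfl

theorem norm_torusOp_le : ‖torusOp Θ g M‖ ≤ ‖M‖ :=
  (norm_blockOp_le _ _ _ _).trans_eq (abs_norm M)

theorem torusOp_mul_torusOp :
    torusOp Θ g M * torusOp Θ h N =
      torusOp Θ (g + h) ((torusChar Θ (h.1 - h.2) (-(g.1 + g.2)) : ℂ) • (M * N)) := by
  ext ψ k : 3
  simp only [mul_apply_eq_comp, torusOp_apply, smul_apply, Prod.fst_add, Prod.snd_add,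
    add_sub_add_comm, torusChar_add, AddChar.mul_apply, sub_eq_add_neg k, AddChar.map_add_eq_mul,
    map_smul, smul_smul, Circle.coe_mul, mul_assoc]
  abel_nf

theorem torusOp_zero_smul_one (c : ℂ) :
    torusOp Θ 0 (c • 1) = algebraMap ℂ (Hil n →L[ℂ] Hil n) c := by
  ext ψ k : 3
  simp [torusOp_apply, torusChar_zero, Algebra.algebraMap_eq_smul_one]

theorem weyl_eq_torusOp (l : Mode n) :
    weyl Θ l M = torusOp Θ (l, 0) ((torusChar Θ l (-l) : ℂ) • M) := by
  ext ψ k : 3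
  simp only [weyl, blockOp_apply, ← coe_torusChar, torusOp_apply, smul_apply, Equiv.subRight_apply,
    sub_zero, add_zero, smul_smul, ← Circle.coe_mul, ← AddChar.map_add_eq_mul, ← sub_eq_add_neg]

/-- `C₀ M C₀⁻¹`. -/
def conjC0 (S : SpinStructure n) : Spinor n →L[ℂ] Spinor n :=
  S.C0.toContinuousLinearEquiv.toContinuousLinearMap.comp
    (M.comp S.C0.symm.toContinuousLinearEquiv.toContinuousLinearMap)

theorem norm_conjC0_le (S : SpinStructure n) : ‖conjC0 M S‖ ≤ ‖M‖ := by
  refine ContinuousLinearMap.opNorm_le_bound _ (norm_nonneg _) fun v => ?_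
  calc ‖S.C0 (M (S.C0.symm v))‖ ≤ ‖M‖ * ‖S.C0.symm v‖ := by
        rw [LinearIsometryEquiv.norm_map]
        exact M.le_opNorm _
    _ = ‖M‖ * ‖v‖ := by rw [LinearIsometryEquiv.norm_map]

theorem conjJ_torusOp (S : SpinStructure n) :
    conjJ S (torusOp Θ g M) = torusOp Θ (-g.2, -g.1) (conjC0 M S) := by
  ext ψ k : 3
  change S.C0 ((torusChar Θ (g.1 - g.2) (-k) : ℂ) •
    M (S.C0.symm (ψ (-(-k - (g.1 + g.2)))))) = _
  rw [LinearIsometryEquiv.map_smulₛₗ, ← Circle.coe_inv_eq_conj, AddChar.map_neg_eq_inv, inv_inv,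
    torusOp_apply, show -(-k - (g.1 + g.2)) = k - (-g.2 + -g.1) by abel,
    neg_sub_neg]
  rfl

end TorusOp

/-! ### Smooth operators -/

/-- `T` is a series of twisted translations with frequencies in `H` and rapidly decaying
coefficients. -/
def IsSmoothOp (Θ : Matrix (Fin n) (Fin n) ℝ) (H : AddSubgroup (Mode n × Mode n))
    (T : Hil n →L[ℂ] Hil n) : Prop :=
  ∃ (ι : Type) (g : ι → Mode n × Mode n) (M : ι → Spinor n →L[ℂ] Spinor n),
    (∀ i, g i ∈ H) ∧ HasRapidDecay g M ∧ HasSum (fun i => torusOp Θ (g i) (M i)) T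

section SmoothOp

variable {Θ : Matrix (Fin n) (Fin n) ℝ} {H K : AddSubgroup (Mode n × Mode n)}
  {T T' : Hil n →L[ℂ] Hil n}

theorem HasRapidDecay.summable_norm_torusOp {ι : Type*} {g : ι → Mode n × Mode n}
    {M : ι → Spinor n →L[ℂ] Spinor n} (hM : HasRapidDecay g M) :
    Summable fun i => ‖torusOp Θ (g i) (M i)‖ :=
  hM.summable_norm.of_nonneg_of_le (fun _ => norm_nonneg _) fun _ => norm_torusOp_le _ _ _

theorem IsSmoothOp.add (hT : IsSmoothOp Θ H T) (hT' : IsSmoothOp Θ H T') :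
    IsSmoothOp Θ H (T + T') := by
  obtain ⟨ι, g, M, hg, hM, hT⟩ := hT
  obtain ⟨ι', g', M', hg', hM', hT'⟩ := hT'
  exact ⟨ι ⊕ ι', Sum.elim g g', Sum.elim M M', Sum.forall.mpr ⟨hg, hg'⟩, hM.sumElim hM',
    HasSum.sum (f := fun i => torusOp Θ (Sum.elim g g' i) (Sum.elim M M' i)) hT hT'⟩

theorem IsSmoothOp.mul (hT : IsSmoothOp Θ H T) (hT' : IsSmoothOp Θ H T') :
    IsSmoothOp Θ H (T * T') := by
  obtain ⟨ι, g, M, hg, hM, hT⟩ := hT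
  obtain ⟨ι', g', M', hg', hM', hT'⟩ := hT'
  refine ⟨ι × ι', fun p => g p.1 + g' p.2, fun p =>
    (torusChar Θ ((g' p.2).1 - (g' p.2).2) (-((g p.1).1 + (g p.1).2)) : ℂ) • (M p.1 * M' p.2),
    fun p => H.add_mem (hg _) (hg' _), ?_, ?_⟩
  · refine (hM.add_mul hM').of_norm_le (C := 1) (d := 0) (fun _ => le_rfl) fun p => ?_
    rw [norm_smul, Circle.norm_coe, pow_zero, mul_one]
  · simp only [← torusOp_mul_torusOp]
    rw [← hT.tsum_eq, ← hT'.tsum_eq,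
      tsum_mul_tsum_of_summable_norm hM.summable_norm_torusOp hM'.summable_norm_torusOp]
    exact (summable_mul_of_summable_norm hM.summable_norm_torusOp
      hM'.summable_norm_torusOp).hasSum

theorem isSmoothOp_algebraMap (c : ℂ) : IsSmoothOp Θ H (algebraMap ℂ _ c) :=
  ⟨Unit, fun _ => 0, fun _ => c • 1, fun _ => H.zero_mem, fun _ => (hasSum_fintype _).summable,
    torusOp_zero_smul_one Θ c ▸ hasSum_unique _⟩

variable (Θ H) in
/-- The algebra of smooth operators with frequencies in `H`. -/
def smoothAlg : Subalgebra ℂ (Hil n →L[ℂ] Hil n) where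
  carrier := {T | IsSmoothOp Θ H T}
  mul_mem' := IsSmoothOp.mul
  add_mem' := IsSmoothOp.add
  algebraMap_mem' := isSmoothOp_algebraMap

theorem smoothAlg_mono (h : H ≤ K) : smoothAlg Θ H ≤ smoothAlg Θ K :=
  fun _ ⟨ι, g, M, hg, hM, hT⟩ => ⟨ι, g, M, fun i => h (hg i), hM, hT⟩

end SmoothOp

/-- The frequencies of left multiplications. -/
def leftModes (n : ℕ) : AddSubgroup (Mode n × Mode n) :=
  (AddMonoidHom.snd (Mode n) (Mode n)).ker

/-- The frequencies of right multiplications. -/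
def rightModes (n : ℕ) : AddSubgroup (Mode n × Mode n) :=
  (AddMonoidHom.fst (Mode n) (Mode n)).ker

section Generators

variable {Θ : Matrix (Fin n) (Fin n) ℝ}

theorem conjJ_mem_smoothAlg (S : SpinStructure n) {T : Hil n →L[ℂ] Hil n}
    (hT : T ∈ smoothAlg Θ (leftModes n)) : conjJ S T ∈ smoothAlg Θ (rightModes n) := by
  obtain ⟨ι, g, M, hg, hM, hT⟩ := hT
  have rapidDecay_conj :
      HasRapidDecay (fun i => (-(g i).2, -(g i).1)) fun i => conjC0 (M i) S := by
    refine hM.of_norm_le (C := 1) (d := 0) (fun i => ?_) fun i => ?_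
    · rw [Prod.norm_def, Prod.norm_def, norm_neg, norm_neg, max_comm]
    · simpa using norm_conjC0_le (M i) S
  have hasSum_conj := (rapidDecay_conj.summable_norm_torusOp (Θ := Θ)).of_norm.hasSum
  refine ⟨ι, _, _, fun i => neg_eq_zero.mpr (hg i), rapidDecay_conj, ?_⟩
  convert! hasSum_conj
  ext ψ : 1
  simp only [← conjJ_torusOp] at hasSum_conj ⊢
  exact ((hT.mapL (ContinuousLinearMap.apply ℂ (Hil n) (realJInv S ψ))).mapL (realJ S)).unique
    (hasSum_conj.mapL (ContinuousLinearMap.apply ℂ (Hil n) ψ))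

section Weyl

variable {M : Mode n → Spinor n →L[ℂ] Spinor n}

theorem HasRapidDecay.summable_weyl (hM : HasRapidDecay (fun l => l) M) :
    Summable fun l => weyl Θ l (M l) :=
  .of_norm (hM.summable_norm.of_nonneg_of_le (fun _ => norm_nonneg _) fun _ => norm_weyl_le _ _ _)

theorem HasRapidDecay.tsum_weyl_mem_smoothAlg (hM : HasRapidDecay (fun l => l) M) :
    ∑' l, weyl Θ l (M l) ∈ smoothAlg Θ (leftModes n) := by
  refine ⟨Mode n, fun l => (l, 0), fun l => (torusChar Θ l (-l) : ℂ) • M l, fun l => rfl, ?_, ?_⟩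
  · refine hM.of_norm_le (C := 1) (d := 0) (fun l => ?_) fun l => ?_
    · simp [Prod.norm_def]
    · rw [norm_smul, Circle.norm_coe, pow_zero, mul_one]
  · simpa only [weyl_eq_torusOp] using (hM.summable_weyl (Θ := Θ)).hasSum

/-- Only the term `l = r - k` maps the mode `k` to the mode `r`. -/
theorem HasRapidDecay.tsum_weyl_single_apply (hM : HasRapidDecay (fun l => l) M) (k r : Mode n)
    (v : Spinor n) :
    (∑' l, weyl Θ l (M l)) (lp.single 2 k v) r =
      Complex.exp (-(Complex.I / 2) * (pairing Θ (r - k) k : ℂ)) • M (r - k) v := by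
  have hasSum_apply := ((hM.summable_weyl (Θ := Θ)).hasSum.mapL (ContinuousLinearMap.apply ℂ (Hil n)
    (lp.single 2 k v : Hil n))).mapL (lp.evalCLM ℂ (fun _ : Mode n => Spinor n) 2 r)
  have hasSum_term : HasSum (fun l => Complex.exp (-(Complex.I / 2) * (pairing Θ l (r - l) : ℂ)) •
      M l (Pi.single (M := fun _ => Spinor n) k v (r - l))) _ :=
    hasSum_single (r - k) fun l hl => by
      rw [Pi.single_eq_of_ne fun h => hl (by rw [← h]; abel), map_zero, smul_zero]
  rw [sub_sub_cancel, Pi.single_eq_same] at hasSum_term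
  exact hasSum_apply.unique hasSum_term

end Weyl

theorem leftMul_eq_tsum_weyl (a : Mode n → ℂ) (M : Spinor n →L[ℂ] Spinor n) :
    leftMul Θ a M = ∑' l, weyl Θ l (a l • M) := by
  refine tsum_congr fun l => ?_
  ext ψ k : 3
  exact smul_comm (a l) (_ : ℂ) (M (ψ (k - l)))

theorem IsSchwartz.hasRapidDecay_smul {a : Mode n → ℂ} (ha : IsSchwartz a)
    (M : Spinor n →L[ℂ] Spinor n) : HasRapidDecay (fun l => l) fun l => a l • M := by
  refine ha.hasRapidDecay.of_norm_le (C := ‖M‖) (d := 0) (fun _ => le_rfl) fun l => ?_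
  rw [norm_smul, pow_zero, mul_one, mul_comm]

theorem IsSchwartz.leftMul_mem_smoothAlg {a : Mode n → ℂ} (ha : IsSchwartz a)
    (M : Spinor n →L[ℂ] Spinor n) : leftMul Θ a M ∈ smoothAlg Θ (leftModes n) :=
  leftMul_eq_tsum_weyl (Θ := Θ) a M ▸ (ha.hasRapidDecay_smul M).tsum_weyl_mem_smoothAlg

theorem torusAlg_subset_smoothAlg : torusAlg n Θ ⊆ smoothAlg Θ (leftModes n) := by
  rintro _ ⟨a, ha, rfl⟩
  exact ha.leftMul_mem_smoothAlg 1

variable (S : SpinStructure n)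

theorem oneForm_mem_smoothAlg {a : Fin n → Mode n → ℂ} (ha : ∀ α, IsSchwartz (a α)) :
    oneForm Θ S a ∈ smoothAlg Θ (leftModes n) :=
  sum_mem fun α _ => Subalgebra.smul_mem _ ((ha α).leftMul_mem_smoothAlg _) _

theorem norm_slash_le (k : Mode n) : ‖slash S k‖ ≤ (∑ μ, ‖S.gamma μ‖) * ‖k‖ := by
  rw [slash, Finset.sum_mul]
  refine norm_sum_le_of_le _ fun μ _ => ?_
  rw [norm_smul, mul_comm, Complex.norm_intCast, ← Int.norm_eq_abs]
  gcongr
  exact norm_le_pi_norm k μ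

theorem slash_sub (k l : Mode n) : slash S (k - l) = slash S k - slash S l := by
  simp [slash, sub_smul]

theorem IsSchwartz.hasRapidDecay_smul_slash {a : Mode n → ℂ} (ha : IsSchwartz a) :
    HasRapidDecay (fun l => l) fun l => a l • slash S l := by
  refine ha.hasRapidDecay.of_norm_le (C := ∑ μ, ‖S.gamma μ‖) (d := 1) (fun _ => le_rfl)
    fun l => ?_
  calc ‖a l • slash S l‖ ≤ ‖a l‖ * ((∑ μ, ‖S.gamma μ‖) * (1 + ‖l‖)) := by
        rw [norm_smul]
        gcongr
        refine (norm_slash_le S l).trans ?_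
        gcongr
        linarith
    _ = (∑ μ, ‖S.gamma μ‖) * (1 + ‖l‖) ^ 1 * ‖a l‖ := by ring

theorem exists_dirac_single (k : Mode n) (v : Spinor n) :
    ∃ h : (lp.single 2 k v : Hil n) ∈ (dirac S).domain,
      dirac S ⟨(lp.single 2 k v : Hil n), h⟩ = (lp.single 2 k (slash S k v) : Hil n) := by
  have slash_single : (fun r => slash S r ((lp.single 2 k v : Hil n) r)) =
      (lp.single 2 k (slash S k v) : Hil n) := by
    funext r
    obtain rfl | hr := eq_or_ne r k
    · simp
    · simp [Pi.single_eq_of_ne hr]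
  have memℓp_slash : Memℓp (fun r => slash S r ((lp.single 2 k v : Hil n) r)) 2 :=
    slash_single ▸ lp.memℓp _
  exact ⟨memℓp_slash, lp.ext slash_single⟩

theorem IsCommutator.single_apply {S : SpinStructure n} {T C : Hil n →L[ℂ] Hil n}
    (hC : IsCommutator (dirac S) T C) (k r : Mode n) (v : Spinor n) :
    C (lp.single 2 k v) r =
      slash S r (T (lp.single 2 k v) r) - T (lp.single 2 k (slash S k v)) r := by
  obtain ⟨h, dirac_single⟩ := exists_dirac_single S k v
  obtain ⟨h', sub_eq⟩ := hC ⟨_, h⟩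
  rw [← sub_eq, dirac_single]
  rfl

theorem IsCommutator.eq_tsum_weyl {S : SpinStructure n} {a : Mode n → ℂ} (ha : IsSchwartz a)
    {C : Hil n →L[ℂ] Hil n} (hC : IsCommutator (dirac S) (leftMul Θ a 1) C) :
    C = ∑' l, weyl Θ l (a l • slash S l) := by
  refine lp.ext_continuousLinearMap ENNReal.ofNat_ne_top fun k => ?_
  ext v r : 3
  change C (lp.single 2 k v) r = (∑' l, weyl Θ l (a l • slash S l)) (lp.single 2 k v) r
  rw [hC.single_apply, leftMul_eq_tsum_weyl, (ha.hasRapidDecay_smul 1).tsum_weyl_single_apply,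
    (ha.hasRapidDecay_smul 1).tsum_weyl_single_apply,
    (ha.hasRapidDecay_smul_slash S).tsum_weyl_single_apply, slash_sub]
  simp only [smul_apply, one_apply_eq_self, map_smul, sub_apply, smul_sub]

theorem diracComm_subset_smoothAlg : diracComm Θ S ⊆ smoothAlg Θ (leftModes n) := by
  rintro C ⟨_, ⟨a, ha, rfl⟩, hC⟩
  rw [hC.eq_tsum_weyl ha]
  exact (ha.hasRapidDecay_smul_slash S).tsum_weyl_mem_smoothAlg

theorem oneForms_le_smoothAlg :
    oneForms Θ S ≤ Subalgebra.toSubmodule (smoothAlg Θ (leftModes n)) := by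
  refine Submodule.span_le.mpr ?_
  rintro _ ⟨T, hT, C, hC, rfl⟩
  exact Subalgebra.mul_mem _ (torusAlg_subset_smoothAlg hT) (diracComm_subset_smoothAlg S hC)

theorem bigAlg_le_smoothAlg : bigAlg Θ S ≤ smoothAlg Θ ⊤ := by
  refine Algebra.adjoin_le ?_
  rintro T (((hT | hT) | ⟨T, hT, rfl⟩) | ⟨T, hT, rfl⟩)
  · exact smoothAlg_mono le_top (torusAlg_subset_smoothAlg hT)
  · exact smoothAlg_mono le_top (diracComm_subset_smoothAlg S hT)
  · exact smoothAlg_mono le_top (conjJ_mem_smoothAlg S (torusAlg_subset_smoothAlg hT))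
  · exact smoothAlg_mono le_top (conjJ_mem_smoothAlg S (diracComm_subset_smoothAlg S hT))

end Generators

/-! ### Small divisors -/

/-- Whenever `(l, -l)`, with `l ≠ 0`, belongs to `H`, the character of the twisted translation with
frequency `(l, -l)` takes at some unit vector a value whose distance to `1` is at least a negative
power of `1 + ‖l‖`. -/
def HasSmallDivisorBound (Θ : Matrix (Fin n) (Fin n) ℝ) (H : AddSubgroup (Mode n × Mode n)) :
    Prop :=
  ∃ (C : ℝ) (N : ℕ), ∀ l : Mode n, l ≠ 0 → (l, -l) ∈ H →
    ∃ j, 1 ≤ C * (1 + ‖l‖) ^ N * ‖(torusChar Θ (l + l) (unitMode j) : ℂ) - 1‖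

theorem hasSmallDivisorBound_leftModes (Θ : Matrix (Fin n) (Fin n) ℝ) :
    HasSmallDivisorBound Θ (leftModes n) :=
  ⟨0, 0, fun _ hl h => absurd (neg_eq_zero.mp h) hl⟩

theorem hasSmallDivisorBound_rightModes (Θ : Matrix (Fin n) (Fin n) ℝ) :
    HasSmallDivisorBound Θ (rightModes n) :=
  ⟨0, 0, fun _ hl h => absurd h hl⟩

theorem four_mul_abs_sub_round_le_norm_exp_sub_one (x : ℝ) :
    4 * |x - round x| ≤ ‖(Circle.exp (2 * Real.pi * x) : ℂ) - 1‖ := by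
  have exp_eq : Circle.exp (2 * Real.pi * x) = Circle.exp (2 * Real.pi * (x - round x)) := by
    rw [mul_sub, Circle.exp_sub, mul_comm _ (round x : ℝ), Circle.exp_int_mul_two_pi, div_one]
  have abs_pi_mul : |Real.pi * (x - round x)| = Real.pi * |x - round x| := by
    rw [abs_mul, abs_of_pos Real.pi_pos]
  have jordan : 2 / Real.pi * |Real.pi * (x - round x)| ≤ |Real.sin (Real.pi * (x - round x))| :=
    Real.mul_abs_le_abs_sin <| by
      rw [abs_pi_mul]
      nlinarith [abs_sub_round x, Real.pi_pos]
  rw [exp_eq, Circle.coe_exp, mul_comm _ Complex.I, Complex.norm_exp_I_mul_ofReal_sub_one,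
    norm_mul, Real.norm_ofNat, Real.norm_eq_abs, mul_assoc, mul_div_cancel_left₀ _ two_ne_zero]
  rw [abs_pi_mul, ← mul_assoc, div_mul_cancel₀ _ Real.pi_ne_zero] at jordan
  linarith

theorem sqrt_sum_sq_le_sum_abs {ι : Type*} [Fintype ι] (x : ι → ℝ) :
    √(∑ i, x i ^ 2) ≤ ∑ i, |x i| := by
  refine Real.sqrt_le_iff.mpr ⟨by positivity, ?_⟩
  simpa only [sq_abs] using
    Finset.sum_sq_le_sq_sum_of_nonneg (s := Finset.univ) fun i _ => abs_nonneg (x i)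

theorem modeNorm_le_card_mul_norm (k : Mode n) : modeNorm k ≤ n * ‖k‖ :=
  calc modeNorm k ≤ ∑ i, |(k i : ℝ)| := sqrt_sum_sq_le_sum_abs _
    _ ≤ ∑ _i : Fin n, ‖k‖ := by
        gcongr with i
        simpa [Int.norm_eq_abs] using norm_le_pi_norm k i
    _ = n * ‖k‖ := by simp

theorem IsDiophantine.exists_le_abs_sub_round {A : Matrix (Fin n) (Fin n) ℝ}
    (hA : IsDiophantine A) :
    ∃ δ c : ℝ, 0 < c ∧ ∀ q : Mode n, q ≠ 0 → ∃ j,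
      c * modeNorm q ^ (-δ) ≤ |A.mulVec (fun i => (q i : ℝ)) j -
        round (A.mulVec (fun i => (q i : ℝ)) j)| := by
  obtain ⟨δ, -, c, hc, hA⟩ := hA
  refine ⟨δ, c / (n + 1), by positivity, fun q hq => ?_⟩
  set x := A.mulVec fun i => (q i : ℝ)
  have le_sum_abs : c * modeNorm q ^ (-δ) ≤ ∑ j, |x j - round (x j)| :=
    (hA q hq fun j => round (x j)).trans (sqrt_sum_sq_le_sum_abs _)
  obtain ⟨i, -⟩ := Function.ne_iff.mp hq
  obtain ⟨j, -, hj⟩ := Finset.exists_le_of_sum_le ⟨i, Finset.mem_univ i⟩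
    (f := fun _ => c / (n + 1) * modeNorm q ^ (-δ)) (g := fun j => |x j - round (x j)|) <| by
      refine le_trans ?_ le_sum_abs
      rw [Finset.sum_const, Finset.card_univ, Fintype.card_fin, nsmul_eq_mul, ← mul_assoc]
      gcongr
      · exact Real.rpow_nonneg (modeNorm_nonneg q) _
      · field_simp
        linarith
  exact ⟨j, hj⟩

theorem torusChar_add_self_unitMode {Θ : Matrix (Fin n) (Fin n) ℝ} (hΘ : Θ.transpose = -Θ)
    (l : Mode n) (j : Fin n) :
    torusChar Θ (l + l) (unitMode j) =
      Circle.exp (2 * Real.pi * ((2 * Real.pi)⁻¹ • Θ).mulVec (fun i => (l i : ℝ)) j) := by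
  have skew (i : Fin n) : Θ i j = -Θ j i := congrFun₂ hΘ j i
  have pairing_unitMode : pairing Θ l (unitMode j) = -Θ.mulVec (fun i => (l i : ℝ)) j := by
    simp [pairing, unitMode, Pi.single_apply, Matrix.mulVec, dotProduct, skew, mul_comm]
  change Circle.exp _ = _
  rw [pairing_add_left, add_self_div_two, pairing_unitMode, neg_neg, Matrix.smul_mulVec,
    Pi.smul_apply, smul_eq_mul, mul_inv_cancel_left₀ (by positivity)]

theorem IsDiophantine.hasSmallDivisorBound {Θ : Matrix (Fin n) (Fin n) ℝ}
    (hΘ : Θ.transpose = -Θ) (h : IsDiophantine ((2 * Real.pi)⁻¹ • Θ)) :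
    HasSmallDivisorBound Θ ⊤ := by
  obtain ⟨δ, c, hc, h⟩ := h.exists_le_abs_sub_round
  obtain ⟨N, hN⟩ := exists_nat_gt δ
  refine ⟨c⁻¹ * n ^ N, N, fun l hl _ => (h l hl).imp fun j hj => ?_⟩
  rw [torusChar_add_self_unitMode hΘ]
  set x := ((2 * Real.pi)⁻¹ • Θ).mulVec (fun i => (l i : ℝ)) j
  have rpow_le : modeNorm l ^ δ ≤ n ^ N * (1 + ‖l‖) ^ N :=
    calc modeNorm l ^ δ ≤ modeNorm l ^ (N : ℝ) :=
          Real.rpow_le_rpow_of_exponent_le (one_le_modeNorm hl) hN.le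
      _ = modeNorm l ^ N := Real.rpow_natCast _ _
      _ ≤ (n * (1 + ‖l‖)) ^ N := by
          refine pow_le_pow_left₀ (modeNorm_nonneg l) ?_ N
          exact (modeNorm_le_card_mul_norm l).trans (by gcongr; linarith)
      _ = n ^ N * (1 + ‖l‖) ^ N := mul_pow _ _ _
  calc 1 = c⁻¹ * modeNorm l ^ δ * (c * modeNorm l ^ (-δ)) := by
        rw [Real.rpow_neg (modeNorm_nonneg l)]
        have := Real.rpow_pos_of_pos (modeNorm_pos hl) δ
        field_simp
    _ ≤ c⁻¹ * (n ^ N * (1 + ‖l‖) ^ N) * ‖(Circle.exp (2 * Real.pi * x) : ℂ) - 1‖ := by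
        gcongr
        · exact mul_nonneg hc.le (Real.rpow_nonneg (modeNorm_nonneg l) _)
        · linarith [four_mul_abs_sub_round_le_norm_exp_sub_one x, abs_nonneg (x - round x)]
    _ = c⁻¹ * n ^ N * (1 + ‖l‖) ^ N * ‖(Circle.exp (2 * Real.pi * x) : ℂ) - 1‖ := by ring

/-! ### Diagonal blocks -/

/-- The block of `T` which maps the fibre of `Hil n` over the mode `k` to itself. -/
def diagBlock (k : Mode n) : (Hil n →L[ℂ] Hil n) →L[ℂ] (Spinor n →L[ℂ] Spinor n) :=
  (lp.evalCLM ℂ (fun _ : Mode n => Spinor n) 2 k).postcomp (Spinor n) ∘L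
    (lp.singleContinuousLinearMap ℂ (fun _ : Mode n => Spinor n) 2 k).precomp (Hil n)

theorem diagBlock_apply (k : Mode n) (T : Hil n →L[ℂ] Hil n) (v : Spinor n) :
    diagBlock k T v = T (lp.single 2 k v : Hil n) k := rfl

theorem diagBlock_torusOp (Θ : Matrix (Fin n) (Fin n) ℝ) (g : Mode n × Mode n)
    (M : Spinor n →L[ℂ] Spinor n) (k : Mode n) :
    diagBlock k (torusOp Θ g M) =
      if g.1 + g.2 = 0 then (torusChar Θ (g.1 - g.2) k : ℂ) • M else 0 := by
  ext1 v
  rw [diagBlock_apply, torusOp_apply, lp.single_apply, Pi.single_apply]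
  simp only [sub_eq_self]
  split_ifs <;> simp

theorem diagBlock_torusOp_eq_zero_mode {Θ : Matrix (Fin n) (Fin n) ℝ} {g : Mode n × Mode n}
    (hg : g.1 + g.2 = 0 → g.1 = 0) {M : Spinor n →L[ℂ] Spinor n} (k : Mode n) :
    diagBlock k (torusOp Θ g M) = diagBlock 0 (torusOp Θ g M) := by
  simp only [diagBlock_torusOp]
  split_ifs with h
  · have snd_eq : g.2 = 0 := by simpa [hg h] using h
    rw [hg h, snd_eq, sub_zero, torusChar_zero]
    simp
  · rfl

theorem HasRapidDecay.summable_div_pow {ι E F : Type*} [SeminormedAddGroup E]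
    [SeminormedAddGroup F] {g : ι → E} {M : ι → F} (hM : HasRapidDecay g M) {x : ι → ℝ} {C : ℝ}
    {D : ℕ} (hx₀ : ∀ i, 0 ≤ x i) (hx : ∀ i, 1 ≤ C * (1 + ‖g i‖) ^ D * x i) (N : ℕ) :
    Summable fun i => ‖M i‖ / x i ^ N := by
  refine Summable.of_nonneg_of_le (fun i => div_nonneg (norm_nonneg _) (pow_nonneg (hx₀ i) N))
    (fun i => ?_) ((hM (D * N)).mul_left (C ^ N))
  have x_pos : 0 < x i := (hx₀ i).lt_of_ne fun h => by
    have := hx i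
    rw [← h, mul_zero] at this
    linarith
  rw [div_le_iff₀ (pow_pos x_pos N)]
  calc ‖M i‖ ≤ (C * (1 + ‖g i‖) ^ D * x i) ^ N * ‖M i‖ :=
        le_mul_of_one_le_left (norm_nonneg _) (one_le_pow₀ (hx i))
    _ = C ^ N * ((1 + ‖g i‖) ^ (D * N) * ‖M i‖) * x i ^ N := by ring

theorem HasRapidDecay.isDiffExact_tsum_mul_torusChar {Θ : Matrix (Fin n) (Fin n) ℝ}
    {H : AddSubgroup (Mode n × Mode n)} (hH : HasSmallDivisorBound Θ H) {ι : Type*}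
    {l : ι → Mode n} {c : ι → ℂ} (hc : HasRapidDecay l c) (hl : ∀ i, l i ≠ 0)
    (hlH : ∀ i, (l i, -l i) ∈ H) :
    IsDiffExact fun k => ∑' i, c i * (torusChar Θ (l i + l i) k : ℂ) := by
  obtain ⟨C, D, hH⟩ := hH
  choose j hj using fun i => hH (l i) (hl i) (hlH i)
  refine isDiffExact_tsum_mul_circleChar j (fun i h => ?_)
    (hc.summable_div_pow (fun _ => norm_nonneg _) hj)
  have := hj i
  rw [h, Circle.coe_one, sub_self, norm_zero, mul_zero] at this
  linarith

theorem exists_isDiffExact_diagBlock_sub {Θ : Matrix (Fin n) (Fin n) ℝ}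
    {H : AddSubgroup (Mode n × Mode n)} (hH : HasSmallDivisorBound Θ H) {T : Hil n →L[ℂ] Hil n}
    (hT : T ∈ smoothAlg Θ H) (φ : (Spinor n →L[ℂ] Spinor n) →L[ℂ] ℂ) :
    ∃ c, IsDiffExact fun k => φ (diagBlock k T) - c := by
  obtain ⟨ι, g, M, hg, hM, hT⟩ := hT
  let s : Set ι := {i | (g i).1 + (g i).2 = 0 ∧ (g i).1 ≠ 0}
  let f (k : Mode n) (i : ι) : ℂ := φ (diagBlock k (torusOp Θ (g i) (M i)))
  have hasSum_f (k : Mode n) : HasSum (f k) (φ (diagBlock k T)) := (hT.mapL (diagBlock k)).mapL φ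
  have f_of_mem (k : Mode n) (i : s) :
      f k i = φ (M i) * (torusChar Θ ((g i).1 + (g i).1) k : ℂ) := by
    have sub_eq : (g i).1 - (g i).2 = (g i).1 + (g i).1 := by
      rw [eq_neg_of_add_eq_zero_right i.2.1, sub_neg_eq_add]
    simp only [f]
    rw [diagBlock_torusOp, if_pos i.2.1, map_smul, smul_eq_mul, mul_comm, sub_eq]
  have f_of_notMem (k : Mode n) (i : (sᶜ : Set ι)) : f k i = f 0 i :=
    congrArg φ (diagBlock_torusOp_eq_zero_mode (fun h => not_not.mp fun h' => i.2 ⟨h, h'⟩) k)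
  refine ⟨∑' i : (sᶜ : Set ι), f 0 i, ?_⟩
  have sub_eq (k : Mode n) : φ (diagBlock k T) - ∑' i : (sᶜ : Set ι), f 0 i =
      ∑' i : s, φ (M i) * (torusChar Θ ((g i).1 + (g i).1) k : ℂ) := by
    rw [← (hasSum_f k).tsum_eq, ← (hasSum_f k).summable.tsum_subtype_add_tsum_subtype_compl s,
      tsum_congr (f_of_notMem k), add_sub_cancel_right, tsum_congr (f_of_mem k)]
  simp only [sub_eq]
  refine HasRapidDecay.isDiffExact_tsum_mul_torusChar hH ?_ (fun i : s => i.2.2) fun i => ?_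
  · refine (hM.comp_injective (e := ((↑) : s → ι)) Subtype.val_injective).of_norm_le (C := ‖φ‖)
      (d := 0) (fun i => norm_fst_le (g i)) fun i => ?_
    rw [pow_zero, mul_one]
    exact φ.le_opNorm (M i)
  · rw [← eq_neg_of_add_eq_zero_right i.2.1]
    exact hg i

/-! ### Traces -/

/-- The trace on the operators of the spinor space, as a continuous linear functional. -/
def spinorTrace (n : ℕ) : (Spinor n →L[ℂ] Spinor n) →L[ℂ] ℂ :=
  LinearMap.toContinuousLinearMap (LinearMap.trace ℂ (Spinor n) ∘ₗ ContinuousLinearMap.coeLM ℂ)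

theorem spinorTrace_eq_sum_inner (M : Spinor n →L[ℂ] Spinor n) :
    spinorTrace n M = ∑ j, inner ℂ (spinorBasis n j) (M (spinorBasis n j)) :=
  LinearMap.trace_eq_sum_inner _ (spinorBasis n)

theorem orthonormal_basisVec (n : ℕ) : Orthonormal ℂ (basisVec (n := n)) := by
  classical
  rw [orthonormal_iff_ite]
  rintro ⟨k, i⟩ ⟨l, j⟩
  rw [basisVec, basisVec, lp.inner_single_left, lp.single_apply, Pi.single_apply]
  by_cases hkl : k = l
  · subst hkl
    simp [(orthonormal_iff_ite.mp (spinorBasis n).orthonormal) i j]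
  · simp [hkl]

/-- The Hilbert basis of `Hil n` formed by the vectors `basisVec p`. -/
def hilBasis (n : ℕ) : HilbertBasis (Mode n × Fin (2 ^ (n / 2))) ℂ (Hil n) :=
  HilbertBasis.mkOfOrthogonalEqBot (orthonormal_basisVec n) <| by
    refine (Submodule.eq_bot_iff _).mpr fun ψ hψ => ?_
    ext1
    funext k
    rw [← (spinorBasis n).sum_repr' (ψ k)]
    refine Finset.sum_eq_zero fun j _ => ?_
    have := (Submodule.mem_orthogonal _ _).mp hψ (basisVec (k, j)) (Submodule.subset_span ⟨_, rfl⟩)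
    rw [basisVec, lp.inner_single_left] at this
    rw [this, zero_smul]

theorem hasSum_inner_smul_basisVec (ψ : Hil n) :
    HasSum (fun p => (inner ℂ (basisVec p) ψ : ℂ) • basisVec p) ψ := by
  have coe_hilBasis : ⇑(hilBasis n) = basisVec := HilbertBasis.coe_mkOfOrthogonalEqBot _ _
  simpa only [HilbertBasis.repr_apply_apply, coe_hilBasis] using (hilBasis n).hasSum_repr ψ

theorem norm_basisVec (p : Mode n × Fin (2 ^ (n / 2))) : ‖basisVec p‖ = 1 :=
  (orthonormal_basisVec n).1 p

theorem isTraceClass_of_summable_norm {T : Hil n →L[ℂ] Hil n}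
    (hT : Summable fun p => ‖T (basisVec p)‖) : IsTraceClass T := by
  refine ⟨_, fun p => T (basisVec p), basisVec, ?_, fun ψ => ?_⟩
  · simpa only [norm_basisVec, mul_one] using hT
  · simpa only [map_smul] using (hasSum_inner_smul_basisVec ψ).mapL T

theorem opTrace_eq_tsum_spinorTrace {T : Hil n →L[ℂ] Hil n}
    (hT : Summable fun p => ‖T (basisVec p)‖) :
    opTrace T = ∑' k, spinorTrace n (diagBlock k T) := by
  have summable_inner : Summable fun p => (inner ℂ (basisVec p) (T (basisVec p)) : ℂ) :=
    hT.of_norm_bounded fun p =>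
      (norm_inner_le_norm _ _).trans_eq (by rw [norm_basisVec, one_mul])
  rw [opTrace, summable_inner.tsum_prod]
  refine tsum_congr fun k => ?_
  rw [tsum_fintype, spinorTrace_eq_sum_inner]
  simp only [basisVec, lp.inner_single_left, diagBlock_apply]

/-- The eigenvalue of `|D|^(-s)` on the fibre of `Hil n` over the mode `k`. -/
def absSymbol (s : ℂ) (k : Mode n) : ℂ :=
  if k = 0 then 1 else (modeNorm k : ℂ) ^ (-s)

theorem blockOp_refl_single (M : Mode n → Spinor n →L[ℂ] Spinor n) (C : ℝ)
    (hM : ∀ k v, ‖M k v‖ ≤ C * ‖v‖) (k : Mode n) (v : Spinor n) :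
    blockOp (Equiv.refl _) M C hM (lp.single 2 k v) = (lp.single 2 k (M k v) : Hil n) := by
  ext1
  funext r
  rw [blockOp_apply, Equiv.refl_apply, lp.single_apply, lp.single_apply]
  obtain rfl | h := eq_or_ne r k
  · simp
  · simp [h]

theorem absDiracPow_single {s : ℂ} (hs : 0 ≤ s.re) (k : Mode n) (v : Spinor n) :
    absDiracPow n s hs (lp.single 2 k v) = absSymbol s k • (lp.single 2 k v : Hil n) := by
  rw [absDiracPow, blockOp_refl_single, ← lp.single_smul]
  rfl

theorem diracInv_pow_single (S : SpinStructure n) (q : ℕ) (k : Mode n) (v : Spinor n) :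
    (diracInv S ^ q) (lp.single 2 k v) = (lp.single 2 k ((diracInvSymbol S k ^ q) v) : Hil n) := by
  induction q with
  | zero => rfl
  | succ q ih =>
    rw [pow_succ', pow_succ', mul_apply_eq_comp, ih, diracInv, blockOp_refl_single,
      mul_apply_eq_comp]

theorem diagBlock_mul_diracInv_pow_mul_absDiracPow (S : SpinStructure n) (T : Hil n →L[ℂ] Hil n)
    (q : ℕ) {s : ℂ} (hs : 0 ≤ s.re) (k : Mode n) :
    diagBlock k (T * diracInv S ^ q * absDiracPow n s hs) =
      diagBlock k T * absSymbol s k • diracInvSymbol S k ^ q := by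
  ext1 v
  rw [diagBlock_apply, mul_apply_eq_comp, mul_apply_eq_comp, absDiracPow_single, ← lp.single_smul,
    diracInv_pow_single, map_smul]
  rfl

theorem summable_norm_absSymbol {s : ℂ} (hs : n < s.re) :
    Summable fun k : Mode n => ‖absSymbol s k‖ := by
  refine (summable_congr_cofinite ?_).mpr
    (summable_modeNorm_rpow (n := n) (r := -s.re) (by linarith))
  filter_upwards [(Set.finite_singleton (0 : Mode n)).compl_mem_cofinite] with k hk
  have hk : k ≠ 0 := hk
  rw [absSymbol, if_neg hk, Complex.norm_cpow_eq_rpow_re_of_pos (modeNorm_pos hk), Complex.neg_re]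

theorem summable_norm_mul_absDiracPow_basisVec (B : Hil n →L[ℂ] Hil n) {s : ℂ} (hs₀ : 0 ≤ s.re)
    (hs : n < s.re) : Summable fun p => ‖(B * absDiracPow n s hs₀) (basisVec p)‖ := by
  have summable_prod : Summable fun p : Mode n × Fin (2 ^ (n / 2)) => ‖absSymbol s p.1‖ * (1 : ℝ) :=
    (summable_norm_absSymbol hs).mul_of_nonneg (hasSum_fintype _).summable
      (fun _ => norm_nonneg _) (fun _ => zero_le_one)
  refine Summable.of_nonneg_of_le (fun _ => norm_nonneg _) (fun p => ?_)
    (summable_prod.mul_left ‖B‖)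
  rw [mul_apply_eq_comp, basisVec, absDiracPow_single, map_smul, norm_smul, mul_one, mul_comm]
  gcongr
  exact (B.le_opNorm _).trans_eq (by rw [← basisVec, norm_basisVec, mul_one])

/-! ### Symbols and residues -/

theorem diracInvSymbol_sq (S : SpinStructure n) {k : Mode n} (hk : k ≠ 0) :
    diracInvSymbol S k ^ 2 = ((modeNorm k : ℂ) ^ 2)⁻¹ • (1 : Spinor n →L[ℂ] Spinor n) := by
  have modeNorm_ne_zero : (modeNorm k : ℂ) ≠ 0 := by exact_mod_cast (modeNorm_pos hk).ne'
  rw [diracInvSymbol, if_neg hk, pow_two, smul_mul_smul_comm, slash_sq, smul_smul]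
  congr 1
  push_cast
  field_simp

theorem diracInvSymbol_pow_two_mul (S : SpinStructure n) (r : ℕ) {k : Mode n} (hk : k ≠ 0) :
    diracInvSymbol S k ^ (2 * r) =
      ((modeNorm k : ℂ) ^ (2 * r))⁻¹ • (1 : Spinor n →L[ℂ] Spinor n) := by
  rw [pow_mul, diracInvSymbol_sq S hk, smul_pow, one_pow, pow_mul, inv_pow]

theorem diracInvSymbol_pow_two_mul_add_one (S : SpinStructure n) (r : ℕ) {k : Mode n}
    (hk : k ≠ 0) :
    diracInvSymbol S k ^ (2 * r + 1) = ((modeNorm k : ℂ) ^ (2 * r + 2))⁻¹ • slash S k := by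
  rw [pow_succ, diracInvSymbol_pow_two_mul S r hk, diracInvSymbol, if_neg hk, smul_mul_smul_comm,
    one_mul, pow_add, mul_inv, Complex.ofReal_inv, Complex.ofReal_pow]

theorem absSymbol_mul_inv_pow (μ : Fin n) (s : ℂ) (d q : ℕ) {k : Mode n} (hk : k ≠ 0) :
    absSymbol s k * ((modeNorm k : ℂ) ^ q)⁻¹ * (k μ : ℂ) ^ d = latticeTerm μ d (s + q) k := by
  have modeNorm_ne_zero : (modeNorm k : ℂ) ≠ 0 := by exact_mod_cast (modeNorm_pos hk).ne'
  rw [absSymbol, latticeTerm, if_neg hk, if_neg hk, neg_add,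
    Complex.cpow_add _ _ modeNorm_ne_zero, Complex.cpow_neg _ (q : ℂ), Complex.cpow_natCast,
    mul_comm]

theorem exists_absSymbol_smul_diracInvSymbol_pow_eq (S : SpinStructure n) (q : ℕ) :
    ∃ (d : ℕ) (G : Fin n → Spinor n →L[ℂ] Spinor n), ∀ (s : ℂ) (k : Mode n),
      absSymbol s k • diracInvSymbol S k ^ q =
        (if k = 0 then 1 else 0) + ∑ μ, latticeTerm μ d (s + (q + d : ℕ)) k • G μ := by
  have at_zero (d : ℕ) (G : Fin n → Spinor n →L[ℂ] Spinor n) (s : ℂ) :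
      absSymbol s (0 : Mode n) • diracInvSymbol S 0 ^ q =
        (if (0 : Mode n) = 0 then 1 else 0) + ∑ μ, latticeTerm μ d (s + (q + d : ℕ)) 0 • G μ := by
    simp [absSymbol, diracInvSymbol, latticeTerm]
  obtain h | ⟨⟨μ₀⟩⟩ := isEmpty_or_nonempty (Fin n)
  · exact ⟨0, 0, fun s k => Subsingleton.elim 0 k ▸ at_zero 0 0 s⟩
  obtain ⟨r, rfl | rfl⟩ := q.even_or_odd'
  · refine ⟨0, Pi.single μ₀ 1, fun s k => ?_⟩
    obtain rfl | hk := eq_or_ne k 0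
    · exact at_zero _ _ s
    rw [Finset.sum_eq_single_of_mem μ₀ (Finset.mem_univ _) fun μ _ hμ => by simp [hμ],
      Pi.single_eq_same, if_neg hk, zero_add, ← absSymbol_mul_inv_pow μ₀ s 0 _ hk, pow_zero,
      mul_one, diracInvSymbol_pow_two_mul S r hk, smul_smul, add_zero]
  · refine ⟨1, S.gamma, fun s k => ?_⟩
    obtain rfl | hk := eq_or_ne k 0
    · exact at_zero _ _ s
    rw [if_neg hk, zero_add, diracInvSymbol_pow_two_mul_add_one S r hk, slash, Finset.smul_sum,
      Finset.smul_sum]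
    refine Finset.sum_congr rfl fun μ _ => ?_
    rw [← absSymbol_mul_inv_pow μ s 1 _ hk, pow_one, smul_smul, smul_smul, mul_assoc]

theorem hasMeromorphicSum_spinorTrace_diagBlock_mul (S : SpinStructure n) {T : Hil n →L[ℂ] Hil n}
    (hT : ∀ φ : (Spinor n →L[ℂ] Spinor n) →L[ℂ] ℂ,
      ∃ c, IsDiffExact fun k => φ (diagBlock k T) - c) {q : ℕ} (hq : q ≠ n) :
    HasMeromorphicSum
      (fun s k => spinorTrace n (diagBlock k T * absSymbol s k • diracInvSymbol S k ^ q)) 0 := by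
  obtain ⟨d, G, hG⟩ := exists_absSymbol_smul_diracInvSymbol_pow_eq S q
  let w (μ : Fin n) (k : Mode n) : ℂ := spinorTrace n (diagBlock k T * G μ)
  have re_ne : ((0 : ℂ) + (q + d : ℕ)).re ≠ n + d := by
    rw [zero_add, Complex.natCast_re]
    exact_mod_cast fun h => hq (Nat.add_right_cancel h)
  have hasMeromorphicSum_w (μ : Fin n) :
      HasMeromorphicSum (fun s k => w μ k * latticeTerm μ d (s + (q + d : ℕ)) k) 0 := by
    obtain ⟨c, hc⟩ := hT (spinorTrace n ∘L
      (ContinuousLinearMap.mul ℂ (Spinor n →L[ℂ] Spinor n)).flip (G μ))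
    exact (hasMeromorphicSum_mul_latticeTerm (w := w μ) hc μ d re_ne).comp_add_const
  have split_sum (s : ℂ) (k : Mode n) :
      spinorTrace n (diagBlock k T * absSymbol s k • diracInvSymbol S k ^ q) =
        (if k = 0 then spinorTrace n (diagBlock 0 T) else 0) +
          ∑ μ, w μ k * latticeTerm μ d (s + (q + d : ℕ)) k := by
    rw [hG, mul_add, Finset.mul_sum, map_add, map_sum]
    congr 1
    · split_ifs with hk
      · rw [hk, mul_one]
      · rw [mul_zero, map_zero]
    · exact Finset.sum_congr rfl fun μ _ => by
        rw [mul_smul_comm, map_smul, smul_eq_mul, mul_comm]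
  simp only [split_sum]
  exact (HasMeromorphicSum.of_hasSum_const (hasSum_ite_eq 0 _)).add
    (HasMeromorphicSum.finset_sum fun μ _ => hasMeromorphicSum_w μ)

theorem hasResidue_zero_of_analyticAt {F : ℂ → ℂ} {z₀ : ℂ} (hF : AnalyticAt ℂ F z₀) :
    HasResidue F z₀ 0 := by
  obtain ⟨ε, hε, hball⟩ := Metric.eventually_nhds_iff_ball.mp hF.eventually_analyticAt
  filter_upwards [Ioo_mem_nhdsGT hε] with r hr
  have differentiableOn_closedBall : DifferentiableOn ℂ F (Metric.closedBall z₀ r) := fun z hz =>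
    (hball z (Metric.closedBall_subset_ball hr.2 hz)).differentiableAt.differentiableWithinAt
  rw [(differentiableOn_closedBall.diffContOnCl_ball subset_rfl).circleIntegral_eq_zero hr.1.le,
    mul_zero]

theorem hasNCIntegral_zero_of_mem_smoothAlg {Θ : Matrix (Fin n) (Fin n) ℝ} (S : SpinStructure n)
    {H : AddSubgroup (Mode n × Mode n)} (hH : HasSmallDivisorBound Θ H) {T : Hil n →L[ℂ] Hil n}
    (hT : T ∈ smoothAlg Θ H) {q : ℕ} (hq : q ≠ n) : HasNCIntegral (T * diracInv S ^ q) 0 := by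
  obtain ⟨F, R, hF, hF₀, hFs⟩ :=
    hasMeromorphicSum_spinorTrace_diagBlock_mul S (exists_isDiffExact_diagBlock_sub hH hT) hq
  refine ⟨F, max R n, le_max_of_le_right n.cast_nonneg, hF, fun s hs => ?_,
    hasResidue_zero_of_analyticAt hF₀⟩
  have summable_norm := summable_norm_mul_absDiracPow_basisVec (T * diracInv S ^ q)
    ((le_max_of_le_right n.cast_nonneg).trans hs.le) ((le_max_right R n).trans_lt hs)
  refine ⟨isTraceClass_of_summable_norm summable_norm, ?_⟩
  rw [opTrace_eq_tsum_spinorTrace summable_norm,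
    ← (hFs s ((le_max_left R n).trans_lt hs)).tsum_eq]
  exact tsum_congr fun k => by rw [diagBlock_mul_diracInv_pow_mul_absDiracPow]

end NCTorus

end

theorem mainTheorem8_general (n : ℕ) (Θ : Matrix (Fin n) (Fin n) ℝ) (hΘ : Θ.transpose = -Θ)
    (S : SpinStructure n) :
    (∀ a : Fin n → Mode n → ℂ, (∀ α, IsSchwartz (a α)) → ∀ p q : ℕ, q ≠ n →
      HasNCIntegral (oneForm Θ S a ^ p * diracInv S ^ q) 0 ∧
      HasNCIntegral ((S.eps • conjJ S (oneForm Θ S a)) ^ p * diracInv S ^ q) 0) ∧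
    (∀ A ∈ oneForms Θ S, ∀ p q : ℕ, q ≠ n → HasNCIntegral (A ^ p * diracInv S ^ q) 0) ∧
    (IsDiophantine ((2 * Real.pi)⁻¹ • Θ) →
      ∀ B ∈ bigAlg Θ S, ∀ q : ℕ, q ≠ n → HasNCIntegral (B * diracInv S ^ q) 0) := by
  have hleft := hasSmallDivisorBound_leftModes Θ
  refine ⟨fun a ha p q hq => ⟨?_, ?_⟩, fun A hA p q hq => ?_, fun hD B hB q hq => ?_⟩
  · exact hasNCIntegral_zero_of_mem_smoothAlg S hleft (pow_mem (oneForm_mem_smoothAlg S ha) p) hq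
  · exact hasNCIntegral_zero_of_mem_smoothAlg S (hasSmallDivisorBound_rightModes Θ)
      (pow_mem (Subalgebra.smul_mem _ (conjJ_mem_smoothAlg S (oneForm_mem_smoothAlg S ha)) _) p) hq
  · exact hasNCIntegral_zero_of_mem_smoothAlg S hleft
      (Subalgebra.pow_mem _ (oneForms_le_smoothAlg S hA) p) hq
  · exact hasNCIntegral_zero_of_mem_smoothAlg S (hD.hasSmallDivisorBound hΘ)
      (bigAlg_le_smoothAlg S hB) hq

theorem mainTheorem8 (n : ℕ) (Θ : Matrix (Fin n) (Fin n) ℝ) (hΘ : Θ.transpose = -Θ)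
    (S : SpinStructure n) :
    (∀ a : Fin n → Mode n → ℂ, (∀ α, IsSchwartz (a α)) → IsSelfAdjoint (oneForm Θ S a) →
      ∀ p q : ℕ, 1 ≤ q → q < n →
        HasNCIntegral (oneForm Θ S a ^ p * diracInv S ^ q) 0 ∧
        HasNCIntegral ((S.eps • conjJ S (oneForm Θ S a)) ^ p * diracInv S ^ q) 0) ∧
    (1 < n → ∀ A ∈ oneForms Θ S, HasNCIntegral (A * diracInv S) 0) ∧
    (IsDiophantine ((2 * Real.pi)⁻¹ • Θ) →
      ∀ B ∈ bigAlg Θ S, ∀ q : ℕ, 1 ≤ q → q < n → HasNCIntegral (B * diracInv S ^ q) 0) :=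
  let ⟨h₁, h₂, h₃⟩ := mainTheorem8_general n Θ hΘ S
  ⟨fun a ha _ p q _ hq => h₁ a ha p q hq.ne,
    fun hn A hA => by simpa only [pow_one] using h₂ A hA 1 1 hn.ne,
    fun hD B hB q _ hq => h₃ hD B hB q hq.ne⟩
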